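/- Let $\mathbb{D}=\{z\in\mathbb{C}:|z|<1\}$. Given numbers $\alpha_{n,N}\in\mathbb{D}$ ($n,N\in\mathbb{N}_0$), let $\Phi_{n,N}$ be the monic polynomials of degree $n$ generated by $\Phi_{0,N}(z)=1$ and $$\Phi_{n+1,N}(z)=z\Phi_{n,N}(z)-\overline{\alpha_{n,N}}\,\Phi^*_{n,N}(z),\qquad \Phi^*_{n,N}(z)=z^n\,\overline{\Phi_{n,N}(1/\bar z)},$$ and, for $n\ge1$, let $\nu_{n,N}=\frac1n\sum_{j=1}^n\delta_{z_{j,n,N}}$ be the counting measure of the zeros $z_{1,n,N},\dots,z_{n,n,N}$ of $\Phi_{n,N}$, repeated according to multiplicity. For a probability measure $\mu$ on $\overline{\mathbb{D}}$ let $\mathcal{P}(\mu)$ denote its balayage onto $\partial\mathbb{D}$, that is, the probability measure on $\partial\mathbb{D}$ such that, for every continuous $f:\partial\mathbb{D}\to\mathbb{C}$, $\int f\,d\mathcal{P}(\mu)=\int_{\overline{\mathbb{D}}}\mathcal{P}_*f\,d\mu$, where $$\mathcal{P}_*f(z)=\frac1{2\pi}\int_0^{2\pi}\frac{1-|z|^2}{|e^{i\theta}-z|^2}f(e^{i\theta})\,d\theta\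 \text{ if } |z|<1,\qquad \mathcal{P}_*f(z)=f(z)\ \text{ if } |z|=1;$$ equivalently, it is the unique probability measure on $\partial\mathbb{D}$ with $\int z^k\,d\mathcal{P}(\mu)=\int z^k\,d\mu$ for all $k\in\mathbb{N}_0$. For $0\le a<1$ let $\theta_a=2\arcsin a$ and let $\nu_a$ be the probability measure on the arc $\{e^{i\theta}:\theta_a\le\theta\le2\pi-\theta_a\}$ with $$\frac{d\nu_a}{d\theta}(e^{i\theta})=\frac1{2\pi}\,\frac{\sin(\theta/2)}{\sqrt{\cos^2(\theta_a/2)-\cos^2(\theta/2)}};$$ put $\nu_1=\delta_{-1}$. The notation $\lim_{n/N\to s}X_{n,N}=X$ means that $X_{n_j,N_j}\to X$ for all sequences of positive integers with $n_j\to\infty$, $N_j\to\infty$ and $n_j/N_j\to s$. **Theorem 5.1.** Let $t>0$, let $\alpha:[0,t]\to\overline{\mathbb{D}}$ be Lebesgue measurable, and let $\{\alpha_{n,N}\}_{n,N\in\mathbb{N}_0}\subset\mathbb{D}$ be such that $$\lim_{n/N\to s}\alpha_{n,N}=\alpha(s)\quad\text{for a.e. } s\in[0,t].$$ Then, in the sense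 of weak convergence of measures, $$\lim_{n/N\to t}\mathcal{P}(\nu_{n,N})=\frac1t\int_0^t\nu_{|\alpha(s)|}\,ds,$$ where the right-hand side is the measure $B\mapsto\frac1t\int_0^t\nu_{|\alpha(s)|}(B)\,ds$. -/

import Mathlib

open MeasureTheory Filter Topology Polynomial
open scoped ENNReal

namespace VaryingOPUC

noncomputable section

/-- The reversed polynomial `p*(z) = z ^ n * conj (p (1 / conj z))` of a polynomial `p` of degree
at most `n`: conjugate the coefficients and reverse their order. -/
def reversed (n : ℕ) (p : ℂ[X]) : ℂ[X] :=
  (p.map (starRingEnd ℂ)).reflect n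

theorem eval_reversed (n : ℕ) (p : ℂ[X]) (hp : p.natDegree ≤ n) (z : ℂ) (hz : z ≠ 0) :
    (reversed n p).eval z = z ^ n * starRingEnd ℂ (p.eval (1 / starRingEnd ℂ z)) := by
  have hz' : z⁻¹ ≠ 0 := inv_ne_zero hz
  let i : Invertible z⁻¹ := invertibleOfNonzero hz'
  have h := eval₂_reflect_mul_pow (RingHom.id ℂ) z⁻¹ n (p.map (starRingEnd ℂ))
    ((natDegree_map_le).trans hp)
  rw [invOf_eq_inv, inv_inv] at h
  have h2 : eval z⁻¹ (p.map (starRingEnd ℂ))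
      = starRingEnd ℂ (p.eval (1 / starRingEnd ℂ z)) := by
    have := Polynomial.hom_eval₂ p (RingHom.id ℂ) (starRingEnd ℂ) (1 / starRingEnd ℂ z)
    simp only [RingHom.comp_id, map_div₀, map_one, RingHomCompTriple.comp_apply,
      RingHom.id_apply] at this
    rw [eval_map, ← one_div, ← this]
    rfl
  rw [← h2]
  change eval z (reflect n _) * _ = eval z⁻¹ _ at h
  rw [← h, reversed, inv_pow, mul_comm, mul_assoc, inv_mul_cancel₀ (pow_ne_zero n hz), mul_one]

/-- The monic orthogonal polynomials on the unit circle with Verblunsky coefficients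
`a 0, a 1, …`, generated by the Szegő recurrence. -/
def opuc (a : ℕ → ℂ) : ℕ → ℂ[X]
  | 0 => 1
  | n + 1 => X * opuc a n - C (starRingEnd ℂ (a n)) * reversed n (opuc a n)

theorem opuc_monic_natDegree (a : ℕ → ℂ) (n : ℕ) :
    (opuc a n).Monic ∧ (opuc a n).natDegree = n := by
  induction n with
  | zero => simp [opuc]
  | succ n ih =>
    obtain ⟨hm, hd⟩ := ih
    have hX : (X * opuc a n).Monic := monic_X.mul hm
    have hXd : (X * opuc a n).degree = ((n + 1 : ℕ) : WithBot ℕ) := by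
      rw [degree_eq_natDegree hX.ne_zero, natDegree_X_mul hm.ne_zero, hd]
    have hr : (reversed n (opuc a n)).natDegree ≤ n := by
      refine natDegree_reflect_le.trans (max_le le_rfl (natDegree_map_le.trans hd.le))
    have hlt : (C (starRingEnd ℂ (a n)) * reversed n (opuc a n)).degree
        < (X * opuc a n).degree := by
      rw [hXd]
      refine lt_of_le_of_lt (degree_le_of_natDegree_le ((natDegree_C_mul_le _ _).trans hr)) ?_
      exact_mod_cast Nat.lt_succ_self n
    refine ⟨hX.sub_of_left hlt, ?_⟩
    refine natDegree_eq_of_degree_eq_some ?_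
    rw [opuc, degree_sub_eq_left_of_degree_lt hlt, hXd]

theorem multiset_sum_dirac_univ (s : Multiset ℂ) :
    (s.map (Measure.dirac : ℂ → Measure ℂ)).sum Set.univ = s.card := by
  induction s using Multiset.induction_on with
  | empty => simp
  | cons z s ih => simp [ih, add_comm]

/-- The normalized zero-counting measure of a polynomial of degree `n ≥ 1`:
`(1 / n) ∑ δ_z`, the sum running over the zeros `z` counted with multiplicity. -/
def zeroMeasureOf (n : ℕ) (p : ℂ[X]) : Measure ℂ :=
  (n : ℝ≥0∞)⁻¹ • (p.roots.map Measure.dirac).sum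

/-- The zero-counting measure of the `n`-th orthogonal polynomial (a probability measure for
`n ≥ 1`; the zero measure for `n = 0`). -/
def zeroMeasure (a : ℕ → ℂ) (n : ℕ) : FiniteMeasure ℂ :=
  ⟨zeroMeasureOf n (opuc a n), ⟨by
    obtain ⟨hm, hd⟩ := opuc_monic_natDegree a n
    rw [zeroMeasureOf, Measure.smul_apply, multiset_sum_dirac_univ, smul_eq_mul,
      splits_iff_card_roots.1 (IsAlgClosed.splits _), hd]
    exact lt_of_le_of_lt (ENNReal.inv_mul_le_one _) ENNReal.one_lt_top⟩⟩

theorem isProbabilityMeasure_zeroMeasure (a : ℕ → ℂ) (n : ℕ) (hn : n ≠ 0) :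
    IsProbabilityMeasure (zeroMeasure a n : Measure ℂ) := by
  obtain ⟨hm, hd⟩ := opuc_monic_natDegree a n
  constructor
  change zeroMeasureOf n (opuc a n) Set.univ = 1
  rw [zeroMeasureOf, Measure.smul_apply, multiset_sum_dirac_univ, smul_eq_mul,
      splits_iff_card_roots.1 (IsAlgClosed.splits _), hd]
  exact ENNReal.inv_mul_cancel (by exact_mod_cast hn) (by simp)

/-- The image on the unit circle of the measure `f θ dθ` on the interval `I` under
`θ ↦ exp (i θ)`. -/
def circleDensity (I : Set ℝ) (f : ℝ → ℝ) : Measure ℂ :=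
  ((volume.restrict I).withDensity fun θ => ENNReal.ofReal (f θ)).map (circleMap 0 1)

/-- The balayage of the unit mass at a point `z` of the closed unit disk onto the unit circle:
the measure with density `P_r(φ - θ) / 2π` (the Poisson kernel) at `exp (i θ)` if
`z = r exp (i φ)` with `r < 1`, and the unit mass at `z` if `|z| = 1`.
(Points outside the closed disk play no role; their mass is left where it is.) -/
def sweep (z : ℂ) : Measure ℂ :=
  if ‖z‖ < 1 then
    circleDensity (Set.Ioc 0 (2 * Real.pi))
      fun θ => (2 * Real.pi)⁻¹ * poissonKernel 0 z (circleMap 0 1 θ)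
  else Measure.dirac z

theorem isProbabilityMeasure_circleDensity {l r : ℝ} (hlr : l ≤ r) {f : ℝ → ℝ}
    (hf : IntervalIntegrable f volume l r) (h0 : ∀ θ ∈ Set.Ioc l r, 0 ≤ f θ)
    (h1 : ∫ θ in l..r, f θ = 1) :
    IsProbabilityMeasure (circleDensity (Set.Ioc l r) f) := by
  have : IsProbabilityMeasure
      ((volume.restrict (Set.Ioc l r)).withDensity fun θ => ENNReal.ofReal (f θ)) := by
    constructor
    rw [withDensity_apply _ MeasurableSet.univ, Measure.restrict_univ,
      ← ofReal_integral_eq_lintegral_ofReal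
        ((intervalIntegrable_iff_integrableOn_Ioc_of_le hlr).1 hf)
        ((ae_restrict_iff' measurableSet_Ioc).2 (ae_of_all _ h0)),
      ← intervalIntegral.integral_of_le hlr, h1, ENNReal.ofReal_one]
  exact Measure.isProbabilityMeasure_map (measurable_circleMap 0 1).aemeasurable

theorem integral_circleDensity {l r : ℝ} (hlr : l ≤ r) {f : ℝ → ℝ} (hf : Measurable f)
    (h0 : ∀ θ ∈ Set.Ioc l r, 0 ≤ f θ) {g : ℂ → ℂ} (hg : Continuous g) :
    ∫ ζ, g ζ ∂circleDensity (Set.Ioc l r) f = ∫ θ in l..r, f θ • g (circleMap 0 1 θ) := by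
  rw [circleDensity, integral_map (measurable_circleMap 0 1).aemeasurable
    hg.aestronglyMeasurable, integral_withDensity_eq_integral_toReal_smul (by fun_prop) (by simp),
    intervalIntegral.integral_of_le hlr]
  refine setIntegral_congr_fun measurableSet_Ioc fun θ hθ => ?_
  simp only [ENNReal.toReal_ofReal (h0 θ hθ)]

theorem measurable_circleDensity {T : Type*} [MeasurableSpace T] {l r : T → ℝ} {f : T → ℝ → ℝ}
    (hl : Measurable l) (hr : Measurable r) (hf : Measurable (Function.uncurry f)) :
    Measurable fun x => circleDensity (Set.Ioc (l x) (r x)) (f x) := by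
  refine (Measure.measurable_map _ (measurable_circleMap 0 1)).comp ?_
  refine Measure.measurable_of_measurable_coe _ fun s hs => ?_
  have hset : MeasurableSet {p : T × ℝ | p.2 ∈ Set.Ioc (l p.1) (r p.1)} :=
    (measurableSet_lt (hl.comp measurable_fst) measurable_snd).inter
      (measurableSet_le measurable_snd (hr.comp measurable_fst))
  have h2 : Measurable fun p : T × ℝ =>
      ({p : T × ℝ | p.2 ∈ Set.Ioc (l p.1) (r p.1)}.indicator
        (fun p => ENNReal.ofReal (f p.1 p.2)) p) :=
    (ENNReal.measurable_ofReal.comp hf).indicator hset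
  have h3 := h2.lintegral_prod_right' (ν := volume.restrict s)
  convert h3 using 2 with x
  rw [← withDensity_indicator measurableSet_Ioc, withDensity_apply _ hs]
  rfl

theorem continuous_poissonKernel_circleMap {z : ℂ} (hz : ‖z‖ < 1) :
    Continuous fun θ => poissonKernel 0 z (circleMap 0 1 θ) := by
  unfold poissonKernel
  refine Continuous.div (by fun_prop) (by fun_prop) fun θ h => ?_
  have : circleMap 0 1 θ = z := by simpa [sub_eq_zero] using h
  have h2 : ‖circleMap 0 1 θ‖ = 1 := by simp
  rw [this] at h2
  linarith

theorem poissonKernel_circleMap_nonneg {z : ℂ} (hz : ‖z‖ < 1) (θ : ℝ) :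
    0 ≤ (2 * Real.pi)⁻¹ * poissonKernel 0 z (circleMap 0 1 θ) := by
  unfold poissonKernel
  have h2 : ‖circleMap 0 1 θ‖ = 1 := by simp
  have h3 : ‖z‖ ^ 2 ≤ 1 := by nlinarith [norm_nonneg z]
  simp only [sub_zero, h2]
  have : 0 ≤ 1 ^ 2 - ‖z‖ ^ 2 := by linarith
  positivity

theorem integral_poissonKernel_pow {z : ℂ} (hz : ‖z‖ < 1) (k : ℕ) :
    ∫ θ in (0 : ℝ)..2 * Real.pi, ((2 * Real.pi)⁻¹ * poissonKernel 0 z (circleMap 0 1 θ)) •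
      (circleMap 0 1 θ) ^ k = z ^ k := by
  have hd : DiffContOnCl ℂ (fun w : ℂ => w ^ k) (Metric.ball 0 1) :=
    (differentiable_id.pow k).diffContOnCl
  have h := hd.circleAverage_poissonKernel_smul (w := z) (by simpa using hz)
  rw [Real.circleAverage_def, ← intervalIntegral.integral_smul] at h
  rw [← h]
  refine intervalIntegral.integral_congr fun θ _ => ?_
  simp only [Pi.smul_apply', smul_smul]

instance isProbabilityMeasure_sweep (z : ℂ) : IsProbabilityMeasure (sweep z) := by
  unfold sweep
  split_ifs with hz
  · refine isProbabilityMeasure_circleDensity (by positivity) ?_ ?_ ?_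
    · exact ((continuous_poissonKernel_circleMap hz).const_mul _).intervalIntegrable _ _
    · exact fun θ _ => poissonKernel_circleMap_nonneg hz θ
    · have h := integral_poissonKernel_pow hz 0
      simp only [pow_zero, Complex.real_smul, mul_one, intervalIntegral.integral_ofReal] at h
      exact_mod_cast h
  · infer_instance

theorem measurable_sweep : Measurable sweep := by
  refine Measurable.ite (measurableSet_lt measurable_norm measurable_const) ?_
    Measure.measurable_dirac
  refine measurable_circleDensity measurable_const measurable_const ?_
  unfold poissonKernel Function.uncurry
  have : Measurable (circleMap 0 1) := measurable_circleMap 0 1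
  fun_prop

theorem integral_sweep_pow (z : ℂ) (k : ℕ) : ∫ ζ, ζ ^ k ∂sweep z = z ^ k := by
  unfold sweep
  split_ifs with h
  · rw [integral_circleDensity (by positivity)
      ((continuous_poissonKernel_circleMap h).const_mul _).measurable
      (fun θ _ => poissonKernel_circleMap_nonneg h θ) (continuous_pow k)]
    exact integral_poissonKernel_pow h k
  · simp

theorem sweep_compl_sphere {z : ℂ} (hz : ‖z‖ ≤ 1) : sweep z (Metric.sphere 0 1)ᶜ = 0 := by
  unfold sweep
  split_ifs with h
  · rw [circleDensity, Measure.map_apply (measurable_circleMap 0 1)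
      Metric.isClosed_sphere.measurableSet.compl]
    have : circleMap 0 1 ⁻¹' (Metric.sphere (0 : ℂ) 1)ᶜ = ∅ := by
      ext θ
      simp
    rw [this, measure_empty]
  · have : ‖z‖ = 1 := le_antisymm hz (not_lt.1 h)
    rw [Measure.dirac_apply' _ Metric.isClosed_sphere.measurableSet.compl]
    simp [this]

/-- The balayage `P(μ)` onto the unit circle of a finite measure `μ` carried by the closed unit
disk: `∫ f dP(μ) = ∫ (∫ f d(sweep z)) dμ(z)`. -/
def balayage (μ : FiniteMeasure ℂ) : FiniteMeasure ℂ :=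
  ⟨(μ : Measure ℂ).bind sweep, ⟨by
    rw [Measure.bind_apply MeasurableSet.univ measurable_sweep.aemeasurable]
    simp⟩⟩

theorem isProbabilityMeasure_balayage (μ : FiniteMeasure ℂ)
    [IsProbabilityMeasure (μ : Measure ℂ)] :
    IsProbabilityMeasure (balayage μ : Measure ℂ) := by
  constructor
  change (μ : Measure ℂ).bind sweep Set.univ = 1
  rw [Measure.bind_apply MeasurableSet.univ measurable_sweep.aemeasurable]
  simp

/-- The balayage is carried by the unit circle. -/
theorem balayage_sphere (μ : FiniteMeasure ℂ)
    (hμ : ∀ᵐ z ∂(μ : Measure ℂ), ‖z‖ ≤ 1) :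
    (balayage μ : Measure ℂ) (Metric.sphere 0 1)ᶜ = 0 := by
  change (μ : Measure ℂ).bind sweep _ = 0
  rw [Measure.bind_apply Metric.isClosed_sphere.measurableSet.compl measurable_sweep.aemeasurable,
    lintegral_congr_ae (hμ.mono fun z hz => sweep_compl_sphere hz), lintegral_zero]

/-- The balayage has the same moments of non-negative order as the measure itself; among the
measures on the unit circle this characterizes it. -/
theorem integral_balayage_pow (μ : FiniteMeasure ℂ)
    (hμ : ∀ᵐ z ∂(μ : Measure ℂ), ‖z‖ ≤ 1) (k : ℕ) :
    ∫ ζ, ζ ^ k ∂(balayage μ : Measure ℂ) = ∫ z, z ^ k ∂(μ : Measure ℂ) := by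
  let κ : ProbabilityTheory.Kernel ℂ ℂ := ⟨sweep, measurable_sweep⟩
  have hb : (balayage μ : Measure ℂ)
      = (κ.comp (ProbabilityTheory.Kernel.const Unit (μ : Measure ℂ))) () := by
    rw [ProbabilityTheory.Kernel.comp_apply, ProbabilityTheory.Kernel.const_apply]
    rfl
  have hint : Integrable (fun ζ : ℂ => ζ ^ k) (balayage μ : Measure ℂ) := by
    refine Integrable.of_bound (continuous_pow k).aestronglyMeasurable 1 ?_
    have : ∀ᵐ ζ ∂(balayage μ : Measure ℂ), ζ ∈ Metric.sphere (0 : ℂ) 1 :=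
      balayage_sphere μ hμ
    filter_upwards [this] with ζ hζ
    simp [mem_sphere_zero_iff_norm.1 hζ]
  rw [hb] at hint ⊢
  rw [ProbabilityTheory.Kernel.integral_comp hint]
  exact integral_congr_ae (ae_of_all _ fun z => integral_sweep_pow z k)

/-- The angle `θ_a = 2 arcsin a`. -/
def arcAngle (a : ℝ) : ℝ := 2 * Real.arcsin a

/-- The density (in the angle) of the equilibrium measure of the arc
`{exp (i θ) : θ_a ≤ θ ≤ 2π - θ_a}`. -/
def arcDensity (a θ : ℝ) : ℝ :=
  (2 * Real.pi)⁻¹ *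
    (Real.sin (θ / 2) / √(Real.cos (arcAngle a / 2) ^ 2 - Real.cos (θ / 2) ^ 2))

/-- The equilibrium measure `ν_a` of the arc `{exp (i θ) : θ_a ≤ θ ≤ 2π - θ_a}` for `0 ≤ a ≤ 1`;
for `a = 1` it is the unit mass at `-1`. (Other values of `a` play no role.) -/
def arcMeasure (a : ℝ) : Measure ℂ :=
  if 0 ≤ a ∧ a < 1 then
    circleDensity (Set.Ioc (arcAngle a) (2 * Real.pi - arcAngle a)) (arcDensity a)
  else Measure.dirac (-1)

theorem measurable_arcMeasure : Measurable arcMeasure := by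
  refine Measurable.ite measurableSet_Ico ?_ measurable_const
  have h : Measurable arcAngle := Real.measurable_arcsin.const_mul 2
  refine measurable_circleDensity h (measurable_const.sub h) ?_
  unfold arcDensity Function.uncurry
  fun_prop

instance isProbabilityMeasure_arcMeasure (a : ℝ) : IsProbabilityMeasure (arcMeasure a) := by
  unfold arcMeasure
  split_ifs with ha
  swap
  · infer_instance
  obtain ⟨h0, h1⟩ := ha
  have hpi := Real.pi_pos
  have hA0 : 0 ≤ Real.arcsin a := Real.arcsin_nonneg.2 h0
  have hA1 : Real.arcsin a < Real.pi / 2 := Real.arcsin_lt_pi_div_two.2 h1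
  have hle : arcAngle a ≤ 2 * Real.pi - arcAngle a := by unfold arcAngle; linarith
  set c := Real.cos (arcAngle a / 2) with hc
  have hcA : arcAngle a / 2 = Real.arcsin a := by unfold arcAngle; ring
  have hcpos : 0 < c := by
    rw [hc, hcA]
    exact Real.cos_pos_of_mem_Ioo ⟨by linarith, hA1⟩
  have hsin : ∀ θ ∈ Set.Ioc (arcAngle a) (2 * Real.pi - arcAngle a), 0 ≤ Real.sin (θ / 2) := by
    intro θ hθ
    have h3 := hθ.1
    have h4 := hθ.2
    unfold arcAngle at h3 h4
    exact Real.sin_nonneg_of_nonneg_of_le_pi (by linarith) (by linarith)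
  have hpos : ∀ θ ∈ Set.Ioc (arcAngle a) (2 * Real.pi - arcAngle a), 0 ≤ arcDensity a θ := by
    intro θ hθ
    have := hsin θ hθ
    unfold arcDensity
    positivity
  let F : ℝ → ℝ := fun θ => -(Real.pi)⁻¹ * Real.arcsin (Real.cos (θ / 2) / c)
  have hcont : Continuous F := by
    have := Real.continuous_arcsin
    fun_prop
  have hder : ∀ θ ∈ Set.Ioo (arcAngle a) (2 * Real.pi - arcAngle a),
      HasDerivAt F (arcDensity a θ) θ := by
    intro θ hθ
    have h3 := hθ.1
    have h4 := hθ.2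
    unfold arcAngle at h3 h4
    have hlt : Real.cos (θ / 2) < c := by
      rw [hc, hcA]
      exact Real.cos_lt_cos_of_nonneg_of_le_pi hA0 (by linarith) (by linarith)
    have hgt : -c < Real.cos (θ / 2) := by
      rw [hc, hcA, ← Real.cos_pi_sub]
      exact Real.cos_lt_cos_of_nonneg_of_le_pi (by linarith) (by linarith) (by linarith)
    have hu1 : Real.cos (θ / 2) / c < 1 := by rwa [div_lt_one hcpos]
    have hu2 : -1 < Real.cos (θ / 2) / c := by rw [lt_div_iff₀ hcpos]; linarith
    have hg : HasDerivAt (fun θ => Real.cos (θ / 2) / c) (-Real.sin (θ / 2) * (1 / 2) / c) θ :=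
      (((hasDerivAt_id θ).div_const 2).cos).div_const c
    have hF := ((Real.hasDerivAt_arcsin hu2.ne' hu1.ne).comp θ hg).const_mul (-(Real.pi)⁻¹)
    refine hF.congr_deriv ?_
    have hsq : √(1 - (Real.cos (θ / 2) / c) ^ 2) = √(c ^ 2 - Real.cos (θ / 2) ^ 2) / c := by
      rw [eq_div_iff hcpos.ne', ← Real.sqrt_sq hcpos.le, Real.sqrt_sq hcpos.le,
        ← Real.sqrt_sq hcpos.le, ← Real.sqrt_mul' _ (sq_nonneg _), Real.sqrt_sq hcpos.le]
      congr 1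
      field_simp
    have hroot : 0 < √(c ^ 2 - Real.cos (θ / 2) ^ 2) := by
      apply Real.sqrt_pos.2
      nlinarith
    rw [hsq, arcDensity, ← hc]
    field_simp
  have hint : IntervalIntegrable (arcDensity a) volume (arcAngle a)
      (2 * Real.pi - arcAngle a) := by
    rw [intervalIntegrable_iff_integrableOn_Ioc_of_le hle]
    exact intervalIntegral.integrableOn_deriv_of_nonneg hcont.continuousOn hder
      fun θ hθ => hpos θ (Set.Ioo_subset_Ioc_self hθ)
  refine isProbabilityMeasure_circleDensity hle hint hpos ?_
  rw [intervalIntegral.integral_eq_sub_of_hasDerivAt_of_le hle hcont.continuousOn hder hint]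
  have e1 : Real.cos ((2 * Real.pi - arcAngle a) / 2) = -c := by
    rw [show (2 * Real.pi - arcAngle a) / 2 = Real.pi - arcAngle a / 2 by ring,
      Real.cos_pi_sub]
  simp only [F, e1, ← hc, neg_div, div_self hcpos.ne', Real.arcsin_neg, Real.arcsin_one]
  field_simp
  norm_num

/-- The average `(1 / t) ∫_0^t ν_{|α(s)|} ds` of the equilibrium measures, that is, the measure
`B ↦ (1 / t) ∫_0^t ν_{|α(s)|}(B) ds` (for `t > 0` and `α` measurable on `[0, t]`). -/
def averageArcMeasure (t : ℝ) (α : ℝ → ℂ) : FiniteMeasure ℂ :=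
  ⟨(ENNReal.ofReal t)⁻¹ •
      (volume.restrict (Set.Icc 0 t)).bind fun s => arcMeasure ‖α s‖, ⟨by
    rcases le_or_gt t 0 with ht | ht
    · have : (volume : Measure ℝ).restrict (Set.Icc 0 t) = 0 := by
        rw [Measure.restrict_eq_zero, Real.volume_Icc]
        simpa using ht
      simp [this]
    · refine ENNReal.mul_lt_top (by simpa using ht) ?_
      refine (Measure.bind_apply_le _ MeasurableSet.univ).trans_lt ?_
      simp⟩⟩

theorem averageArcMeasure_apply {t : ℝ} {α : ℝ → ℂ}
    (hα : AEMeasurable α (volume.restrict (Set.Icc 0 t))) {B : Set ℂ} (hB : MeasurableSet B) :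
    (averageArcMeasure t α : Measure ℂ) B
      = (ENNReal.ofReal t)⁻¹ * ∫⁻ s in Set.Icc 0 t, arcMeasure ‖α s‖ B := by
  have h : AEMeasurable (fun s => arcMeasure ‖α s‖) (volume.restrict (Set.Icc 0 t)) :=
    measurable_arcMeasure.comp_aemeasurable hα.norm
  rw [← Measure.bind_apply hB h]
  rfl

theorem isProbabilityMeasure_averageArcMeasure {t : ℝ} (ht : 0 < t) {α : ℝ → ℂ}
    (hα : AEMeasurable α (volume.restrict (Set.Icc 0 t))) :
    IsProbabilityMeasure (averageArcMeasure t α : Measure ℂ) := by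
  constructor
  rw [averageArcMeasure_apply hα MeasurableSet.univ]
  simpa using ENNReal.inv_mul_cancel (by simpa using ht) (by simp)

/-- `lim_{n/N → t} X n N = L`: the limit along all pairs of sequences `n_j, N_j → ∞` with
`n_j / N_j → t`. -/
def RatioLimit {E : Type*} [TopologicalSpace E] (X : ℕ → ℕ → E) (t : ℝ) (L : E) : Prop :=
  ∀ n N : ℕ → ℕ, Tendsto n atTop atTop → Tendsto N atTop atTop →
    Tendsto (fun j => (n j : ℝ) / (N j : ℝ)) atTop (𝓝 t) →
    Tendsto (fun j => X (n j) (N j)) atTop (𝓝 L)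

end

end VaryingOPUC

/-!
Write `Φₙ*` for the reversed polynomial of `Φₙ`. Its zeros are the inversions of those of `Φₙ`, so
`n⁻¹ log |Φₙ*(z)|` is the logarithmic potential `∫ log |1 - z ζ̄| dνₙ(ζ)`. The Szegő recurrence
turns the same quantity into the average over `k < n` of `log |1 - αₖ z bₖ|`, where
`bₖ = Φₖ / Φₖ*` evaluated at `z` evolves by a Möbius step depending on `αₖ`. For small `|z|` this
step is a contraction of the closed disk, so when the coefficients vary slowly `bₖ` follows its
fixed point, and the average converges to an integral over `s` of `log |1 - α(s) z b(s)|`. For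
constant coefficients of modulus `a`, the fixed-point equation identifies this logarithm with the
potential of the arc measure `ν_a`. Hence the potentials converge on a small circle. Their Fourier
coefficients there are the moments of the measures up to constants, balayage preserves moments, and
on the unit circle moments determine weak convergence.
-/

open scoped ComplexConjugate

namespace VaryingOPUC

/-! ### The Szegő recurrence and the Schur iterates -/

theorem reversed_mul {m n : ℕ} {p q : ℂ[X]} (hp : p.natDegree ≤ m) (hq : q.natDegree ≤ n) :
    reversed (m + n) (p * q) = reversed m p * reversed n q := by
  rw [reversed, Polynomial.map_mul,
    reflect_mul _ _ (natDegree_map_le.trans hp) (natDegree_map_le.trans hq), reversed, reversed]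

theorem reversed_sub (n : ℕ) (p q : ℂ[X]) :
    reversed n (p - q) = reversed n p - reversed n q := by
  rw [reversed, Polynomial.map_sub, reflect_sub, reversed, reversed]

theorem reversed_C_mul (n : ℕ) (c : ℂ) (p : ℂ[X]) :
    reversed n (C c * p) = C (conj c) * reversed n p := by
  rw [reversed, Polynomial.map_mul, map_C, reflect_C_mul, reversed]

theorem reversed_X_sub_C (ζ : ℂ) : reversed 1 (X - C ζ) = 1 - C (conj ζ) * X := by
  simp [reversed, reflect_sub, reflect_C]

theorem reversed_reversed (n : ℕ) (p : ℂ[X]) : reversed n (reversed n p) = p := by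
  rw [reversed, reversed, ← reflect_map, reflect_reflect, Polynomial.map_map]
  simp

theorem natDegree_reversed_le {n : ℕ} {p : ℂ[X]} (hp : p.natDegree ≤ n) :
    (reversed n p).natDegree ≤ n :=
  natDegree_reflect_le.trans (max_le le_rfl (natDegree_map_le.trans hp))

theorem reversed_opuc_succ (a : ℕ → ℂ) (n : ℕ) :
    reversed (n + 1) (opuc a (n + 1))
      = reversed n (opuc a n) - C (a n) * X * opuc a n := by
  have hd : (opuc a n).natDegree ≤ n := (opuc_monic_natDegree a n).2.le
  have hX : reversed (n + 1) (X * opuc a n) = reversed n (opuc a n) := by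
    rw [add_comm, reversed_mul natDegree_X_le hd]
    simp [reversed]
  have hrev : reversed (n + 1) (reversed n (opuc a n)) = X * opuc a n := by
    rw [add_comm, ← one_mul (reversed n _), reversed_mul (by simp) (natDegree_reversed_le hd),
      reversed_reversed]
    simp [reversed]
  rw [opuc, reversed_sub, hX, reversed_C_mul, hrev, Complex.conj_conj, mul_assoc]

theorem reversed_prod_X_sub_C (s : Multiset ℂ) :
    reversed s.card (s.map fun ζ => X - C ζ).prod
      = (s.map fun ζ => 1 - C (conj ζ) * X).prod := by
  induction s using Multiset.induction_on with
  | empty => simp [reversed]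
  | cons ζ s ih =>
    rw [Multiset.card_cons, add_comm, Multiset.map_cons, Multiset.prod_cons,
      reversed_mul (natDegree_X_sub_C ζ).le (natDegree_multiset_prod_X_sub_C_eq_card s).le,
      reversed_X_sub_C, ih, Multiset.map_cons, Multiset.prod_cons]

theorem eval_reversed_opuc (a : ℕ → ℂ) (n : ℕ) (z : ℂ) :
    (reversed n (opuc a n)).eval z = ((opuc a n).roots.map fun ζ => 1 - z * conj ζ).prod := by
  obtain ⟨hmonic, hdegree⟩ := opuc_monic_natDegree a n
  have hsplits : (opuc a n).Splits := IsAlgClosed.splits _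
  have h := reversed_prod_X_sub_C (opuc a n).roots
  rw [splits_iff_card_roots.1 hsplits, hdegree, ← hsplits.eq_prod_roots_of_monic hmonic] at h
  rw [h, eval_multiset_prod, Multiset.map_map]
  simp only [Function.comp_def, eval_sub, eval_one, eval_mul, eval_C, eval_X, mul_comm]

/-- One step `b ↦ (z b - ᾱ) / (1 - α z b)` of the Schur recursion at the point `z`. -/
noncomputable def schurStep (z α b : ℂ) : ℂ := (z * b - conj α) / (1 - α * z * b)

/-- The Schur iterates at `z` of the coefficients `a`, started at `1`: the values at `z` of the
quotients `Φ_n / Φ_n*`. -/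
noncomputable def schurIterate (a : ℕ → ℂ) (z : ℂ) : ℕ → ℂ
  | 0 => 1
  | n + 1 => schurStep z (a n) (schurIterate a z n)

theorem norm_mul_mul_le {z α b : ℂ} (hα : ‖α‖ ≤ 1) (hb : ‖b‖ ≤ 1) : ‖α * z * b‖ ≤ ‖z‖ := by
  calc ‖α * z * b‖ = ‖α‖ * ‖z‖ * ‖b‖ := by rw [norm_mul, norm_mul]
    _ ≤ 1 * ‖z‖ * 1 := by gcongr
    _ = ‖z‖ := by ring

theorem norm_mul_mul_lt_one {z α b : ℂ} (hz : ‖z‖ < 1) (hα : ‖α‖ ≤ 1) (hb : ‖b‖ ≤ 1) :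
    ‖α * z * b‖ < 1 :=
  (norm_mul_mul_le hα hb).trans_lt hz

theorem one_sub_ne_zero_of_norm_lt_one {v : ℂ} (hv : ‖v‖ < 1) : 1 - v ≠ 0 := by
  rintro h
  rw [← sub_eq_zero.1 h, norm_one] at hv
  exact hv.false

theorem norm_sub_conj_le_norm_one_sub_mul {α v : ℂ} (hα : ‖α‖ ≤ 1) (hv : ‖v‖ ≤ 1) :
    ‖v - conj α‖ ≤ ‖1 - α * v‖ := by
  have hdiff : ‖1 - α * v‖ ^ 2 - ‖v - conj α‖ ^ 2 = (1 - ‖α‖ ^ 2) * (1 - ‖v‖ ^ 2) := by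
    simp only [← Complex.normSq_eq_norm_sq, Complex.normSq_apply, Complex.sub_re, Complex.sub_im,
      Complex.mul_re, Complex.mul_im, Complex.conj_re, Complex.conj_im, Complex.one_re,
      Complex.one_im]
    ring
  have hnonneg : 0 ≤ (1 - ‖α‖ ^ 2) * (1 - ‖v‖ ^ 2) :=
    mul_nonneg (sub_nonneg.2 (pow_le_one₀ (norm_nonneg α) hα))
      (sub_nonneg.2 (pow_le_one₀ (norm_nonneg v) hv))
  exact le_of_sq_le_sq (by linarith) (norm_nonneg _)

theorem norm_schurStep_le {z α b : ℂ} (hz : ‖z‖ ≤ 1) (hα : ‖α‖ ≤ 1) (hb : ‖b‖ ≤ 1) :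
    ‖schurStep z α b‖ ≤ 1 := by
  have hv : ‖z * b‖ ≤ 1 := (norm_mul z b).trans_le (mul_le_one₀ hz (norm_nonneg b) hb)
  rw [schurStep, norm_div, mul_assoc]
  exact div_le_one_of_le₀ (norm_sub_conj_le_norm_one_sub_mul hα hv) (norm_nonneg _)

theorem norm_schurIterate_le {a : ℕ → ℂ} (ha : ∀ k, ‖a k‖ ≤ 1) {z : ℂ} (hz : ‖z‖ ≤ 1) (n : ℕ) :
    ‖schurIterate a z n‖ ≤ 1 := by
  induction n with
  | zero => simp [schurIterate]
  | succ n ih => exact norm_schurStep_le hz (ha n) ih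

theorem one_sub_mul_schurIterate_ne_zero {a : ℕ → ℂ} (ha : ∀ k, ‖a k‖ ≤ 1) {z : ℂ}
    (hz : ‖z‖ < 1) (n : ℕ) : 1 - a n * z * schurIterate a z n ≠ 0 :=
  one_sub_ne_zero_of_norm_lt_one
    (norm_mul_mul_lt_one hz (ha n) (norm_schurIterate_le ha hz.le n))

theorem eval_opuc_eq_schurIterate_mul {a : ℕ → ℂ} (ha : ∀ k, ‖a k‖ ≤ 1) {z : ℂ} (hz : ‖z‖ < 1)
    (n : ℕ) : (opuc a n).eval z = schurIterate a z n * (reversed n (opuc a n)).eval z := by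
  induction n with
  | zero => simp [opuc, schurIterate, reversed]
  | succ n ih =>
    have hne := one_sub_mul_schurIterate_ne_zero ha hz n
    have hmul : schurIterate a z (n + 1) * (1 - a n * z * schurIterate a z n)
        = z * schurIterate a z n - conj (a n) := div_mul_cancel₀ _ hne
    rw [reversed_opuc_succ, opuc]
    simp only [eval_sub, eval_mul, eval_X, eval_C, ih]
    linear_combination -(reversed n (opuc a n)).eval z * hmul

theorem eval_reversed_opuc_eq_prod_schurIterate {a : ℕ → ℂ} (ha : ∀ k, ‖a k‖ ≤ 1) {z : ℂ}
    (hz : ‖z‖ < 1) (n : ℕ) :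
    (reversed n (opuc a n)).eval z
      = ∏ m ∈ Finset.range n, (1 - a m * z * schurIterate a z m) := by
  induction n with
  | zero => simp [opuc, reversed]
  | succ n ih =>
    rw [reversed_opuc_succ, Finset.prod_range_succ, ← ih]
    simp only [eval_sub, eval_mul, eval_X, eval_C, eval_opuc_eq_schurIterate_mul ha hz n]
    ring

theorem norm_le_one_of_mem_roots_opuc {a : ℕ → ℂ} (ha : ∀ k, ‖a k‖ ≤ 1) {n : ℕ} {ζ : ℂ}
    (hζ : ζ ∈ (opuc a n).roots) : ‖ζ‖ ≤ 1 := by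
  by_contra! h
  have hζ0 : conj ζ ≠ 0 := by
    rw [Ne, map_eq_zero]
    exact norm_pos_iff.1 (one_pos.trans h)
  have hw : ‖(conj ζ)⁻¹‖ < 1 := by
    rw [norm_inv, Complex.norm_conj]
    exact inv_lt_one_of_one_lt₀ h
  have hne : (reversed n (opuc a n)).eval (conj ζ)⁻¹ ≠ 0 := by
    rw [eval_reversed_opuc_eq_prod_schurIterate ha hw]
    exact Finset.prod_ne_zero_iff.2 fun m _ => one_sub_mul_schurIterate_ne_zero ha hw m
  refine hne ?_
  rw [eval_reversed_opuc]
  refine Multiset.prod_eq_zero (Multiset.mem_map.2 ⟨ζ, hζ, ?_⟩)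
  rw [inv_mul_cancel₀ hζ0, sub_self]

theorem schurStep_sub_schurStep {z α b c : ℂ} (hb : 1 - α * z * b ≠ 0) (hc : 1 - α * z * c ≠ 0) :
    schurStep z α b - schurStep z α c
      = z * (1 - α * conj α) * (b - c) / ((1 - α * z * b) * (1 - α * z * c)) := by
  rw [schurStep, schurStep, div_sub_div _ _ hb hc]
  ring

theorem one_sub_norm_le_norm_one_sub_mul {z α b : ℂ} (hα : ‖α‖ ≤ 1) (hb : ‖b‖ ≤ 1) :
    1 - ‖z‖ ≤ ‖1 - α * z * b‖ := by
  calc 1 - ‖z‖ ≤ ‖(1 : ℂ)‖ - ‖α * z * b‖ := by rw [norm_one]; gcongr; exact norm_mul_mul_le hα hb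
    _ ≤ ‖1 - α * z * b‖ := norm_sub_norm_le _ _

theorem norm_mul_one_sub_mul_conj_le (z : ℂ) {α : ℂ} (hα : ‖α‖ ≤ 1) :
    ‖z * (1 - α * conj α)‖ ≤ ‖z‖ := by
  have hsq : ‖α‖ ^ 2 ≤ 1 := pow_le_one₀ (norm_nonneg α) hα
  have hreal : 1 - α * conj α = ((1 - ‖α‖ ^ 2 : ℝ) : ℂ) := by
    rw [Complex.mul_conj']
    push_cast
    rfl
  rw [norm_mul, hreal, Complex.norm_real, Real.norm_of_nonneg (sub_nonneg.2 hsq)]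
  exact mul_le_of_le_one_right (norm_nonneg z) (by linarith [sq_nonneg ‖α‖])

theorem norm_schurStep_sub_schurStep_le {z α b c : ℂ} (hz : ‖z‖ < 1) (hα : ‖α‖ ≤ 1)
    (hb : ‖b‖ ≤ 1) (hc : ‖c‖ ≤ 1) :
    ‖schurStep z α b - schurStep z α c‖ ≤ ‖z‖ / (1 - ‖z‖) ^ 2 * ‖b - c‖ := by
  rw [schurStep_sub_schurStep (one_sub_ne_zero_of_norm_lt_one (norm_mul_mul_lt_one hz hα hb))
    (one_sub_ne_zero_of_norm_lt_one (norm_mul_mul_lt_one hz hα hc)), norm_div, norm_mul,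
    norm_mul (1 - α * z * b), div_mul_eq_mul_div, sq]
  gcongr
  · exact norm_mul_one_sub_mul_conj_le z hα
  · exact one_sub_norm_le_norm_one_sub_mul hα hb
  · exact one_sub_norm_le_norm_one_sub_mul hα hc

theorem exists_schurStep_eq_self {z α : ℂ} (hz : ‖z‖ < 1) (hsmall : ‖z‖ < (1 - ‖z‖) ^ 2)
    (hα : ‖α‖ ≤ 1) : ∃ b, ‖b‖ ≤ 1 ∧ schurStep z α b = b := by
  have hmaps : Set.MapsTo (schurStep z α) (Metric.closedBall 0 1) (Metric.closedBall 0 1) := by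
    intro b hb
    rw [mem_closedBall_zero_iff] at hb ⊢
    exact norm_schurStep_le hz.le hα hb
  have hq : 0 ≤ ‖z‖ / (1 - ‖z‖) ^ 2 := by positivity
  have hcontr : ContractingWith ⟨‖z‖ / (1 - ‖z‖) ^ 2, hq⟩ (hmaps.restrict (schurStep z α) _ _) := by
    refine ⟨?_, LipschitzWith.of_dist_le_mul fun b c => ?_⟩
    · exact (div_lt_one ((norm_nonneg z).trans_lt hsmall)).2 hsmall
    · rw [Subtype.dist_eq, Subtype.dist_eq, dist_eq_norm, dist_eq_norm]
      exact norm_schurStep_sub_schurStep_le hz hα (mem_closedBall_zero_iff.1 b.2)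
        (mem_closedBall_zero_iff.1 c.2)
  obtain ⟨b, hb, hfix, -⟩ := hcontr.exists_fixedPoint' Metric.isClosed_closedBall.isComplete hmaps
    (Metric.mem_closedBall_self zero_le_one) (edist_ne_top _ _)
  exact ⟨b, mem_closedBall_zero_iff.1 hb, hfix⟩

theorem quadratic_of_schurStep_eq_self {z α b : ℂ} (hne : 1 - α * z * b ≠ 0)
    (hb : schurStep z α b = b) :
    (1 - α * z * b) ^ 2 + z * (1 - (‖α‖ : ℂ) ^ 2) = (1 + z) * (1 - α * z * b) := by
  have hfix : z * b - conj α = b * (1 - α * z * b) := by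
    rw [← div_eq_iff hne]
    exact hb
  rw [← Complex.mul_conj']
  linear_combination α * z * hfix

theorem norm_mul_one_sub_sq_lt {z α b : ℂ} (hz : ‖z‖ < 1) (hsmall : ‖z‖ < (1 - ‖z‖) ^ 2)
    (hα : ‖α‖ ≤ 1) (hb : ‖b‖ ≤ 1) :
    ‖z * (1 - (‖α‖ : ℂ) ^ 2)‖ < ‖1 - α * z * b‖ ^ 2 := by
  rw [← Complex.mul_conj']
  calc ‖z * (1 - α * conj α)‖ ≤ ‖z‖ := norm_mul_one_sub_mul_conj_le z hα
    _ < (1 - ‖z‖) ^ 2 := hsmall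
    _ ≤ ‖1 - α * z * b‖ ^ 2 :=
      pow_le_pow_left₀ (sub_nonneg.2 hz.le) (one_sub_norm_le_norm_one_sub_mul hα hb) 2

/-! ### Potentials -/

/-- The logarithmic potential `∫ log |1 - z ζ̄| dμ(ζ)` of a measure on the closed unit disk,
evaluated at points `z` of the open disk; it is the potential of the image of `μ` under
`ζ ↦ 1 / ζ̄`, normalized to vanish at `0`. -/
noncomputable def logPotential (μ : Measure ℂ) (z : ℂ) : ℝ := ∫ ζ, Real.log ‖1 - z * conj ζ‖ ∂μ

theorem integrable_sum_dirac {Ω E : Type*} [MeasurableSpace Ω] [MeasurableSingletonClass Ω]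
    [NormedAddCommGroup E] (s : Multiset Ω) (f : Ω → E) :
    Integrable f (s.map Measure.dirac).sum := by
  induction s using Multiset.induction_on with
  | empty => simp
  | cons x s ih =>
    rw [Multiset.map_cons, Multiset.sum_cons, integrable_add_measure]
    exact ⟨integrable_dirac (by simp), ih⟩

theorem integral_sum_dirac {Ω E : Type*} [MeasurableSpace Ω] [MeasurableSingletonClass Ω]
    [NormedAddCommGroup E] [NormedSpace ℝ E] [CompleteSpace E] (s : Multiset Ω) (f : Ω → E) :
    ∫ x, f x ∂(s.map Measure.dirac).sum = (s.map f).sum := by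
  induction s using Multiset.induction_on with
  | empty => simp
  | cons x s ih =>
    rw [Multiset.map_cons, Multiset.sum_cons, integral_add_measure (integrable_dirac (by simp))
      (integrable_sum_dirac s f), ih, integral_dirac, Multiset.map_cons, Multiset.sum_cons]

theorem ae_sum_dirac {Ω : Type*} [MeasurableSpace Ω] [MeasurableSingletonClass Ω]
    (s : Multiset Ω) {p : Ω → Prop} (h : ∀ x ∈ s, p x) : ∀ᵐ x ∂(s.map Measure.dirac).sum, p x := by
  induction s using Multiset.induction_on with
  | empty => simp
  | cons x s ih =>
    rw [Multiset.map_cons, Multiset.sum_cons, ae_add_measure_iff, ae_dirac_eq]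
    exact ⟨h x (Multiset.mem_cons_self x s), ih fun y hy => h y (Multiset.mem_cons_of_mem hy)⟩

theorem zeroMeasure_ae_norm_le {a : ℕ → ℂ} (ha : ∀ k, ‖a k‖ ≤ 1) (n : ℕ) :
    ∀ᵐ ζ ∂(zeroMeasure a n : Measure ℂ), ‖ζ‖ ≤ 1 :=
  Measure.ae_smul_measure (ae_sum_dirac _ fun _ hζ => norm_le_one_of_mem_roots_opuc ha hζ) _

theorem norm_mul_conj_le (z : ℂ) {ζ : ℂ} (hζ : ‖ζ‖ ≤ 1) : ‖z * conj ζ‖ ≤ ‖z‖ := by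
  rw [norm_mul, Complex.norm_conj]
  exact mul_le_of_le_one_right (norm_nonneg z) hζ

theorem logPotential_zeroMeasure_eq_log_norm_eval {a : ℕ → ℂ} (ha : ∀ k, ‖a k‖ ≤ 1) (n : ℕ)
    {z : ℂ} (hz : ‖z‖ < 1) :
    logPotential (zeroMeasure a n) z = (n : ℝ)⁻¹ * Real.log ‖(reversed n (opuc a n)).eval z‖ := by
  have hne : ∀ x ∈ (opuc a n).roots.map fun ζ => ‖1 - z * conj ζ‖, x ≠ 0 := by
    intro x hx
    obtain ⟨ζ, hζ, rfl⟩ := Multiset.mem_map.1 hx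
    exact norm_ne_zero_iff.2 (one_sub_ne_zero_of_norm_lt_one
      ((norm_mul_conj_le z (norm_le_one_of_mem_roots_opuc ha hζ)).trans_lt hz))
  have hnorm : ‖(reversed n (opuc a n)).eval z‖
      = ((opuc a n).roots.map fun ζ => ‖1 - z * conj ζ‖).prod := by
    rw [eval_reversed_opuc, ← normHom_apply, map_multiset_prod, Multiset.map_map]
    rfl
  change ∫ ζ, _ ∂zeroMeasureOf n (opuc a n) = _
  rw [hnorm, Real.log_multiset_prod hne, Multiset.map_map, zeroMeasureOf, integral_smul_measure,
    integral_sum_dirac]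
  simp

theorem logPotential_zeroMeasure {a : ℕ → ℂ} (ha : ∀ k, ‖a k‖ ≤ 1) (n : ℕ) {z : ℂ} (hz : ‖z‖ < 1) :
    logPotential (zeroMeasure a n) z
      = (n : ℝ)⁻¹ * ∑ m ∈ Finset.range n, Real.log ‖1 - a m * z * schurIterate a z m‖ := by
  rw [logPotential_zeroMeasure_eq_log_norm_eval ha n hz,
    eval_reversed_opuc_eq_prod_schurIterate ha hz, norm_prod, Real.log_prod fun m _ =>
    norm_ne_zero_iff.2 (one_sub_mul_schurIterate_ne_zero ha hz m)]

theorem abs_log_norm_one_sub_le {v : ℂ} {r : ℝ} (hv : ‖v‖ ≤ r) (hr : r < 1) :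
    |Real.log ‖1 - v‖| ≤ -Real.log (1 - r) := by
  have hr' : 0 < 1 - r := sub_pos.2 hr
  have hlow : 1 - r ≤ ‖1 - v‖ := by
    calc 1 - r ≤ ‖(1 : ℂ)‖ - ‖v‖ := by rw [norm_one]; gcongr
      _ ≤ ‖1 - v‖ := norm_sub_norm_le _ _
  have hup : ‖1 - v‖ ≤ (1 - r)⁻¹ := by
    calc ‖1 - v‖ ≤ ‖(1 : ℂ)‖ + ‖v‖ := norm_sub_le _ _
      _ ≤ 1 + r := by rw [norm_one]; gcongr
      _ ≤ (1 - r)⁻¹ := by rw [← one_div, le_div_iff₀ hr']; nlinarith [sq_nonneg r]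
  rw [abs_le, neg_neg, ← Real.log_inv]
  exact ⟨Real.log_le_log hr' hlow, Real.log_le_log (hr'.trans_le hlow) hup⟩

theorem abs_log_norm_one_sub_mul_conj_le {z ζ : ℂ} (hz : ‖z‖ < 1) (hζ : ‖ζ‖ ≤ 1) :
    |Real.log ‖1 - z * conj ζ‖| ≤ -Real.log (1 - ‖z‖) :=
  abs_log_norm_one_sub_le (norm_mul_conj_le z hζ) hz

theorem measurable_log_norm_one_sub_mul_conj :
    Measurable fun p : ℂ × ℂ => Real.log ‖1 - p.1 * conj p.2‖ :=
  Real.measurable_log.comp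
    (continuous_norm.comp (by fun_prop : Continuous fun p : ℂ × ℂ => 1 - p.1 * conj p.2)).measurable

theorem measurable_log_norm_one_sub_mul_conj_right (z : ℂ) :
    Measurable fun ζ => Real.log ‖1 - z * conj ζ‖ :=
  measurable_log_norm_one_sub_mul_conj.comp measurable_prodMk_left

theorem integrable_log_norm_one_sub_mul_conj {μ : Measure ℂ} [IsFiniteMeasure μ]
    (hμ : ∀ᵐ ζ ∂μ, ‖ζ‖ ≤ 1) {z : ℂ} (hz : ‖z‖ < 1) :
    Integrable (fun ζ => Real.log ‖1 - z * conj ζ‖) μ :=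
  Integrable.of_bound (measurable_log_norm_one_sub_mul_conj_right z).aestronglyMeasurable _
    (hμ.mono fun _ hζ => abs_log_norm_one_sub_mul_conj_le hz hζ)

/-! ### The equilibrium measure of an arc -/

section Arc

variable {E : Type*} [NormedAddCommGroup E] [NormedSpace ℝ E] {a : ℝ}

theorem integral_circleDensity_of_stronglyMeasurable {l r : ℝ} (hlr : l ≤ r) {f : ℝ → ℝ}
    (hf : Measurable f) (h0 : ∀ θ ∈ Set.Ioc l r, 0 ≤ f θ) {g : ℂ → E}
    (hg : StronglyMeasurable g) :
    ∫ ζ, g ζ ∂circleDensity (Set.Ioc l r) f = ∫ θ in l..r, f θ • g (circleMap 0 1 θ) := by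
  rw [circleDensity, integral_map (measurable_circleMap 0 1).aemeasurable
    hg.aestronglyMeasurable, integral_withDensity_eq_integral_toReal_smul (by fun_prop) (by simp),
    intervalIntegral.integral_of_le hlr]
  refine setIntegral_congr_fun measurableSet_Ioc fun θ hθ => ?_
  simp only [ENNReal.toReal_ofReal (h0 θ hθ)]

theorem ae_norm_eq_one_of_compl_sphere {μ : Measure ℂ} (h : μ (Metric.sphere 0 1)ᶜ = 0) :
    ∀ᵐ ζ ∂μ, ‖ζ‖ = 1 := by
  filter_upwards [mem_ae_iff.2 h] with ζ hζ
  exact mem_sphere_zero_iff_norm.1 hζ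

theorem circleDensity_compl_sphere (I : Set ℝ) (f : ℝ → ℝ) :
    circleDensity I f (Metric.sphere 0 1)ᶜ = 0 := by
  rw [circleDensity, Measure.map_apply (measurable_circleMap 0 1)
    Metric.isClosed_sphere.measurableSet.compl]
  convert measure_empty (μ := (volume.restrict I).withDensity fun θ => ENNReal.ofReal (f θ))
  ext θ
  simp

theorem arcMeasure_compl_sphere (a : ℝ) : arcMeasure a (Metric.sphere 0 1)ᶜ = 0 := by
  unfold arcMeasure
  split_ifs
  · exact circleDensity_compl_sphere _ _
  · rw [Measure.dirac_apply' _ Metric.isClosed_sphere.measurableSet.compl]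
    simp

theorem arcAngle_nonneg (h0 : 0 ≤ a) : 0 ≤ arcAngle a :=
  mul_nonneg zero_le_two (Real.arcsin_nonneg.2 h0)

theorem arcAngle_lt_pi (h1 : a < 1) : arcAngle a < Real.pi := by
  have := Real.arcsin_lt_pi_div_two.2 h1
  rw [arcAngle]
  linarith

theorem arcMeasure_of_lt_one (h0 : 0 ≤ a) (h1 : a < 1) :
    arcMeasure a = circleDensity (Set.Ioc (arcAngle a) (2 * Real.pi - arcAngle a)) (arcDensity a) :=
  if_pos ⟨h0, h1⟩

theorem arcDensity_nonneg (h0 : 0 ≤ a) {θ : ℝ}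
    (hθ : θ ∈ Set.Ioc (arcAngle a) (2 * Real.pi - arcAngle a)) : 0 ≤ arcDensity a θ := by
  have hangle := arcAngle_nonneg h0
  have hsin : 0 ≤ Real.sin (θ / 2) :=
    Real.sin_nonneg_of_nonneg_of_le_pi (by linarith [hθ.1]) (by linarith [hθ.2])
  unfold arcDensity
  positivity

theorem integral_arcMeasure (h0 : 0 ≤ a) (h1 : a < 1) {g : ℂ → E} (hg : StronglyMeasurable g) :
    ∫ ζ, g ζ ∂arcMeasure a
      = ∫ θ in arcAngle a..2 * Real.pi - arcAngle a, arcDensity a θ • g (circleMap 0 1 θ) := by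
  rw [arcMeasure_of_lt_one h0 h1, integral_circleDensity_of_stronglyMeasurable
    (by linarith [arcAngle_lt_pi h1]) (by unfold arcDensity; fun_prop)
    (fun θ hθ => arcDensity_nonneg h0 hθ) hg]

theorem integral_conj_arcMeasure [CompleteSpace E] (a : ℝ) {g : ℂ → E}
    (hg : StronglyMeasurable g) : ∫ ζ, g (conj ζ) ∂arcMeasure a = ∫ ζ, g ζ ∂arcMeasure a := by
  by_cases ha : 0 ≤ a ∧ a < 1
  swap
  · simp [arcMeasure, ha]
  have hcircle (θ : ℝ) : conj (circleMap 0 1 θ) = circleMap 0 1 (2 * Real.pi - θ) := by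
    rw [conj_circleMap_zero, sub_eq_neg_add, periodic_circleMap 0 1 (-θ)]
  have hdensity (θ : ℝ) : arcDensity a (2 * Real.pi - θ) = arcDensity a θ := by
    rw [arcDensity, arcDensity, sub_div, mul_div_cancel_left₀ _ two_ne_zero, Real.sin_pi_sub,
      Real.cos_pi_sub, neg_sq]
  have hgconj : StronglyMeasurable fun ζ => g (conj ζ) :=
    hg.comp_measurable Complex.continuous_conj.measurable
  rw [integral_arcMeasure ha.1 ha.2 hg, integral_arcMeasure ha.1 ha.2 hgconj]
  simpa only [hcircle, hdensity, sub_sub_cancel] using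
    intervalIntegral.integral_comp_sub_left (a := arcAngle a) (b := 2 * Real.pi - arcAngle a)
      (fun θ => arcDensity a θ • g (circleMap 0 1 θ)) (2 * Real.pi)

/-- The substitution `θ ↦ 2 arccos (cos (θ / 2) / cos (θ_a / 2))` which maps the arc
`θ_a ≤ θ ≤ 2π - θ_a` onto the whole circle and the equilibrium measure onto the uniform one. -/
noncomputable def arcPhase (a θ : ℝ) : ℝ :=
  2 * Real.arccos (Real.cos (θ / 2) / Real.cos (arcAngle a / 2))

theorem cos_arcAngle_half_pos (h0 : 0 ≤ a) (h1 : a < 1) : 0 < Real.cos (arcAngle a / 2) :=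
  Real.cos_pos_of_mem_Ioo
    ⟨by linarith [arcAngle_nonneg h0, Real.pi_pos], by linarith [arcAngle_lt_pi h1]⟩

theorem cos_arcAngle_half_sq (h0 : 0 ≤ a) (h1 : a ≤ 1) :
    Real.cos (arcAngle a / 2) ^ 2 = 1 - a ^ 2 := by
  rw [arcAngle, mul_div_cancel_left₀ _ two_ne_zero, Real.cos_arcsin, Real.sq_sqrt]
  exact sub_nonneg.2 (pow_le_one₀ h0 h1)

theorem arcPhase_left (h0 : 0 ≤ a) (h1 : a < 1) : arcPhase a (arcAngle a) = 0 := by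
  rw [arcPhase, div_self (cos_arcAngle_half_pos h0 h1).ne', Real.arccos_one, mul_zero]

theorem arcPhase_right (h0 : 0 ≤ a) (h1 : a < 1) :
    arcPhase a (2 * Real.pi - arcAngle a) = 2 * Real.pi := by
  rw [arcPhase, sub_div, mul_div_cancel_left₀ _ two_ne_zero, Real.cos_pi_sub, neg_div,
    div_self (cos_arcAngle_half_pos h0 h1).ne', Real.arccos_neg_one]

theorem cos_half_div_mem_Ioo (h0 : 0 ≤ a) (h1 : a < 1) {θ : ℝ}
    (hθ : θ ∈ Set.Ioo (arcAngle a) (2 * Real.pi - arcAngle a)) :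
    Real.cos (θ / 2) / Real.cos (arcAngle a / 2) ∈ Set.Ioo (-1) 1 := by
  have hangle := arcAngle_nonneg h0
  have hlt : Real.cos (θ / 2) < Real.cos (arcAngle a / 2) :=
    Real.cos_lt_cos_of_nonneg_of_le_pi (by linarith) (by linarith [hθ.2]) (by linarith [hθ.1])
  have hgt : -Real.cos (arcAngle a / 2) < Real.cos (θ / 2) := by
    rw [← Real.cos_pi_sub]
    exact Real.cos_lt_cos_of_nonneg_of_le_pi (by linarith [hθ.1]) (by linarith)
      (by linarith [hθ.2])
  have hpos := cos_arcAngle_half_pos h0 h1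
  exact ⟨by rwa [lt_div_iff₀ hpos, neg_one_mul], by rwa [div_lt_one hpos]⟩

theorem hasDerivAt_arcPhase (h0 : 0 ≤ a) (h1 : a < 1) {θ : ℝ}
    (hθ : θ ∈ Set.Ioo (arcAngle a) (2 * Real.pi - arcAngle a)) :
    HasDerivAt (arcPhase a) (2 * Real.pi * arcDensity a θ) θ := by
  have hpos := cos_arcAngle_half_pos h0 h1
  obtain ⟨hgt, hlt⟩ := cos_half_div_mem_Ioo h0 h1 hθ
  have hquot : HasDerivAt (fun θ => Real.cos (θ / 2) / Real.cos (arcAngle a / 2))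
      (-Real.sin (θ / 2) * (1 / 2) / Real.cos (arcAngle a / 2)) θ :=
    (((hasDerivAt_id θ).div_const 2).cos).div_const _
  refine (((Real.hasDerivAt_arccos hgt.ne' hlt.ne).comp θ hquot).const_mul 2).congr_deriv ?_
  have hroot : √(1 - (Real.cos (θ / 2) / Real.cos (arcAngle a / 2)) ^ 2)
      = √(Real.cos (arcAngle a / 2) ^ 2 - Real.cos (θ / 2) ^ 2) / Real.cos (arcAngle a / 2) := by
    rw [div_pow, one_sub_div (pow_ne_zero 2 hpos.ne'), Real.sqrt_div' _ (sq_nonneg _),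
      Real.sqrt_sq hpos.le]
  rw [hroot, arcDensity]
  field_simp

theorem re_circleMap_eq_cos_arcPhase (h0 : 0 ≤ a) (h1 : a < 1) {θ : ℝ}
    (hθ : θ ∈ Set.Ioo (arcAngle a) (2 * Real.pi - arcAngle a)) :
    (circleMap 0 1 θ).re = -a ^ 2 + (1 - a ^ 2) * (circleMap 0 1 (arcPhase a θ)).re := by
  have hre (φ : ℝ) : (circleMap 0 1 φ).re = 2 * Real.cos (φ / 2) ^ 2 - 1 := by
    rw [← Real.cos_two_mul, mul_div_cancel₀ φ two_ne_zero, circleMap_zero_re, one_mul]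
  obtain ⟨hgt, hlt⟩ := cos_half_div_mem_Ioo h0 h1 hθ
  rw [hre, hre, arcPhase, mul_div_cancel_left₀ _ two_ne_zero, Real.cos_arccos hgt.le hlt.le,
    ← cos_arcAngle_half_sq h0 h1.le]
  have hpos := cos_arcAngle_half_pos h0 h1
  have hsq := cos_arcAngle_half_sq h0 h1.le
  field_simp
  linear_combination hsq

theorem integral_re_arcMeasure [CompleteSpace E] (h0 : 0 ≤ a) (h1 : a ≤ 1) {g : ℝ → E}
    (hg : StronglyMeasurable g) :
    ∫ ζ, g ζ.re ∂arcMeasure a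
      = Real.circleAverage (fun ζ => g (-a ^ 2 + (1 - a ^ 2) * ζ.re)) 0 1 := by
  obtain rfl | h1 := h1.eq_or_lt
  · simp [arcMeasure, Real.circleAverage_const]
  have hle : arcAngle a ≤ 2 * Real.pi - arcAngle a := by linarith [arcAngle_lt_pi h1]
  have hphase : ContinuousOn (arcPhase a) (Set.uIcc (arcAngle a) (2 * Real.pi - arcAngle a)) := by
    have := Real.continuous_arccos
    unfold arcPhase
    fun_prop
  have hgre : StronglyMeasurable fun ζ : ℂ => g ζ.re := hg.comp_measurable Complex.measurable_re
  let G (φ : ℝ) : E := g (-a ^ 2 + (1 - a ^ 2) * (circleMap 0 1 φ).re)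
  have hsubst := intervalIntegral.integral_deriv_smul_comp_of_deriv_nonneg (g := G) hphase
    (by rw [min_eq_left hle, max_eq_right hle]; exact fun θ hθ => hasDerivAt_arcPhase h0 h1 hθ)
    (by
      rw [min_eq_left hle, max_eq_right hle]
      exact fun θ hθ => mul_nonneg (by positivity) (arcDensity_nonneg h0 ⟨hθ.1, hθ.2.le⟩))
  rw [arcPhase_left h0 h1, arcPhase_right h0 h1] at hsubst
  rw [Real.circleAverage_def, ← hsubst, ← intervalIntegral.integral_smul,
    integral_arcMeasure h0 h1 hgre]
  refine intervalIntegral.integral_congr_Ioo_of_le hle fun θ hθ => ?_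
  simp only [G, Function.comp_apply, smul_smul, re_circleMap_eq_cos_arcPhase h0 h1 hθ]
  rw [← mul_assoc, inv_mul_cancel₀ (by positivity), one_mul]

theorem log_norm_one_sub_mul_conj_add_log_norm_one_sub_mul {z ζ : ℂ} (hz : ‖z‖ < 1)
    (hζ : ‖ζ‖ = 1) : Real.log ‖1 - z * conj ζ‖ + Real.log ‖1 - z * ζ‖
      = Real.log ‖1 - 2 * z * (ζ.re : ℂ) + z ^ 2‖ := by
  have hne : 1 - z * ζ ≠ 0 := one_sub_ne_zero_of_norm_lt_one (by rwa [norm_mul, hζ, mul_one])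
  have hne' : 1 - z * conj ζ ≠ 0 :=
    one_sub_ne_zero_of_norm_lt_one ((norm_mul_conj_le z hζ.le).trans_lt hz)
  have hζconj : ζ * conj ζ = 1 := by rw [Complex.mul_conj', hζ]; simp
  rw [← Real.log_mul (norm_ne_zero_iff.2 hne') (norm_ne_zero_iff.2 hne), ← norm_mul]
  congr 2
  linear_combination z ^ 2 * hζconj + 2 * z * Complex.re_eq_add_conj ζ

theorem two_mul_logPotential_arcMeasure (h0 : 0 ≤ a) (h1 : a ≤ 1) {z : ℂ} (hz : ‖z‖ < 1) :
    2 * logPotential (arcMeasure a) z = Real.circleAverage (fun ζ =>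
      Real.log ‖1 - 2 * z * ((-a ^ 2 + (1 - a ^ 2) * ζ.re : ℝ) : ℂ) + z ^ 2‖) 0 1 := by
  have hcircle := ae_norm_eq_one_of_compl_sphere (arcMeasure_compl_sphere a)
  have hint : Integrable (fun ζ => Real.log ‖1 - z * conj ζ‖) (arcMeasure a) :=
    integrable_log_norm_one_sub_mul_conj (hcircle.mono fun _ => le_of_eq) hz
  have hmeas : Measurable fun ζ => Real.log ‖1 - z * ζ‖ := by fun_prop
  have hint' : Integrable (fun ζ => Real.log ‖1 - z * ζ‖) (arcMeasure a) :=
    Integrable.of_bound hmeas.aestronglyMeasurable _ (hcircle.mono fun ζ hζ =>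
      abs_log_norm_one_sub_le (by rw [norm_mul, hζ, mul_one]) hz)
  have hconj : logPotential (arcMeasure a) z = ∫ ζ, Real.log ‖1 - z * ζ‖ ∂arcMeasure a :=
    integral_conj_arcMeasure a hmeas.stronglyMeasurable
  let g (x : ℝ) : ℝ := Real.log ‖1 - 2 * z * (x : ℂ) + z ^ 2‖
  have hg : Measurable g := by fun_prop
  calc 2 * logPotential (arcMeasure a) z
      = ∫ ζ, Real.log ‖1 - z * conj ζ‖ + Real.log ‖1 - z * ζ‖ ∂arcMeasure a := by
        rw [integral_add hint hint', ← hconj, two_mul, logPotential]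
    _ = ∫ ζ, g ζ.re ∂arcMeasure a := integral_congr_ae (hcircle.mono fun _ hζ =>
        log_norm_one_sub_mul_conj_add_log_norm_one_sub_mul hz hζ)
    _ = _ := integral_re_arcMeasure h0 h1 hg.stronglyMeasurable

theorem circleAverage_log_norm_mul_one_sub_mul_one_sub {c B : ℂ} (hc : c ≠ 0) (hB : ‖B‖ < 1) :
    Real.circleAverage (fun ζ => Real.log ‖c * ((1 - B * ζ) * (1 - B * conj ζ))‖) 0 1
      = Real.log ‖c‖ := by
  have hsphere : Set.EqOn (fun ζ => Real.log ‖c * ((1 - B * ζ) * (1 - B * conj ζ))‖)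
      ((fun _ => Real.log ‖c‖) + ((Real.log ‖· - conj B‖) + (Real.log ‖· - B‖)))
      (Metric.sphere 0 |1|) := by
    intro ζ hζ
    rw [abs_one, mem_sphere_zero_iff_norm] at hζ
    have hζconj : ζ * conj ζ = 1 := by rw [Complex.mul_conj', hζ]; simp
    have hne : ‖1 - B * ζ‖ ≠ 0 := norm_ne_zero_iff.2
      (one_sub_ne_zero_of_norm_lt_one (by rwa [norm_mul, hζ, mul_one]))
    have hne' : ‖1 - B * conj ζ‖ ≠ 0 := norm_ne_zero_iff.2
      (one_sub_ne_zero_of_norm_lt_one (by rwa [norm_mul, Complex.norm_conj, hζ, mul_one]))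
    have hleft : ‖1 - B * ζ‖ = ‖ζ - conj B‖ := by
      rw [← Complex.norm_conj (ζ - conj B), map_sub, Complex.conj_conj,
        ← one_mul ‖conj ζ - B‖, ← hζ, ← norm_mul, mul_sub, hζconj, mul_comm]
    have hright : ‖1 - B * conj ζ‖ = ‖ζ - B‖ := by
      rw [← one_mul ‖1 - _‖, ← hζ, ← norm_mul]
      congr 1
      linear_combination -B * hζconj
    simp only [Pi.add_apply]
    rw [norm_mul, norm_mul, Real.log_mul (norm_ne_zero_iff.2 hc) (mul_ne_zero hne hne'),
      Real.log_mul hne hne', hleft, hright]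
  rw [Real.circleAverage_congr_sphere hsphere, Real.circleAverage_add (circleIntegrable_const _ _ _)
    ((circleIntegrable_log_norm_sub_const 1).add (circleIntegrable_log_norm_sub_const 1)),
    Real.circleAverage_add (circleIntegrable_log_norm_sub_const 1)
      (circleIntegrable_log_norm_sub_const 1), Real.circleAverage_const,
    circleAverage_log_norm_sub_const₀ ((Complex.norm_conj B).trans_lt hB),
    circleAverage_log_norm_sub_const₀ hB, add_zero, add_zero]

theorem logPotential_arcMeasure (h0 : 0 ≤ a) (h1 : a ≤ 1) {z w : ℂ} (hz : ‖z‖ < 1)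
    (hw : w ^ 2 + z * (1 - (a : ℂ) ^ 2) = (1 + z) * w)
    (hdom : ‖z * (1 - (a : ℂ) ^ 2)‖ < ‖w‖ ^ 2) :
    logPotential (arcMeasure a) z = Real.log ‖w‖ := by
  have hw0 : w ≠ 0 := by
    rintro rfl
    rw [norm_zero, zero_pow two_ne_zero] at hdom
    exact (norm_nonneg _).not_gt hdom
  obtain ⟨B, hB⟩ : ∃ B, w ^ 2 * B = z * (1 - (a : ℂ) ^ 2) :=
    ⟨_, mul_div_cancel₀ _ (pow_ne_zero 2 hw0)⟩
  have hBnorm : ‖B‖ < 1 := by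
    rw [← hB, norm_mul, norm_pow] at hdom
    exact lt_of_mul_lt_mul_left (hdom.trans_eq (mul_one _).symm) (sq_nonneg _)
  have hBw : w * B = 1 + z - w := mul_left_cancel₀ hw0 (by linear_combination hB + hw)
  have hfactor : Set.EqOn
      (fun ζ => Real.log ‖1 - 2 * z * ((-a ^ 2 + (1 - a ^ 2) * ζ.re : ℝ) : ℂ) + z ^ 2‖)
      (fun ζ => Real.log ‖w ^ 2 * ((1 - B * ζ) * (1 - B * conj ζ))‖) (Metric.sphere 0 |1|) := by
    intro ζ hζ
    rw [abs_one, mem_sphere_zero_iff_norm] at hζ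
    have hζconj : ζ * conj ζ = 1 := by rw [Complex.mul_conj', hζ]; simp
    have hid : 1 - 2 * z * ((-a ^ 2 + (1 - a ^ 2) * ζ.re : ℝ) : ℂ) + z ^ 2
        = w ^ 2 * ((1 - B * ζ) * (1 - B * conj ζ)) := by
      push_cast
      linear_combination -2 * w ^ 2 * B * Complex.re_eq_add_conj ζ + 2 * (ζ.re : ℂ) * hB
        - w ^ 2 * B ^ 2 * hζconj - (w * B + 1 + z - w) * hBw - 2 * hw
    exact congrArg (fun x => Real.log ‖x‖) hid
  have htwice := two_mul_logPotential_arcMeasure h0 h1 hz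
  rw [Real.circleAverage_congr_sphere hfactor,
    circleAverage_log_norm_mul_one_sub_mul_one_sub (pow_ne_zero 2 hw0) hBnorm, norm_pow,
    Real.log_pow] at htwice
  exact mul_left_cancel₀ two_ne_zero htwice

end Arc

/-! ### Limits along `n / N → t` -/

/-- The filter of the pairs `(n, N)` with `n, N → ∞` and `n / N → t`: a `RatioLimit` is a limit
along it, and it is countably generated, so that dominated convergence applies to such limits. -/
noncomputable def ratioFilter (t : ℝ) : Filter (ℕ × ℕ) :=
  atTop ⊓ comap (fun p => (p.1 : ℝ) / p.2) (𝓝 t)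

instance isCountablyGenerated_ratioFilter (t : ℝ) : (ratioFilter t).IsCountablyGenerated := by
  unfold ratioFilter
  infer_instance

theorem tendsto_ratioFilter_iff {ι : Type*} {l : Filter ι} {x : ι → ℕ × ℕ} {t : ℝ} :
    Tendsto x l (ratioFilter t) ↔ Tendsto (fun i => (x i).1) l atTop ∧
      Tendsto (fun i => (x i).2) l atTop ∧
      Tendsto (fun i => ((x i).1 : ℝ) / (x i).2) l (𝓝 t) := by
  rw [ratioFilter, tendsto_inf, tendsto_comap_iff, ← prod_atTop_atTop_eq, tendsto_prod_iff',
    and_assoc]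
  rfl

theorem tendsto_fst_ratioFilter (t : ℝ) : Tendsto Prod.fst (ratioFilter t) atTop :=
  (tendsto_ratioFilter_iff.1 tendsto_id).1

theorem tendsto_snd_ratioFilter (t : ℝ) : Tendsto Prod.snd (ratioFilter t) atTop :=
  (tendsto_ratioFilter_iff.1 tendsto_id).2.1

theorem tendsto_div_ratioFilter (t : ℝ) :
    Tendsto (fun p : ℕ × ℕ => (p.1 : ℝ) / p.2) (ratioFilter t) (𝓝 t) :=
  (tendsto_ratioFilter_iff.1 tendsto_id).2.2

theorem ratioLimit_iff_tendsto {E : Type*} [TopologicalSpace E] {X : ℕ → ℕ → E} {t : ℝ} {L : E} :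
    RatioLimit X t L ↔ Tendsto (fun p : ℕ × ℕ => X p.1 p.2) (ratioFilter t) (𝓝 L) := by
  rw [tendsto_iff_seq_tendsto]
  constructor
  · intro h x hx
    obtain ⟨hn, hN, hs⟩ := tendsto_ratioFilter_iff.1 hx
    exact h _ _ hn hN hs
  · intro h n N hn hN hs
    exact h (fun j => (n j, N j)) (tendsto_ratioFilter_iff.2 ⟨hn, hN, hs⟩)

theorem tendsto_pred_ratioFilter (t : ℝ) :
    Tendsto (fun p : ℕ × ℕ => (p.1 - 1, p.2)) (ratioFilter t) (ratioFilter t) := by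
  have hinv : Tendsto (fun p : ℕ × ℕ => (p.2 : ℝ)⁻¹) (ratioFilter t) (𝓝 0) :=
    tendsto_inv_atTop_zero.comp (tendsto_natCast_atTop_atTop.comp (tendsto_snd_ratioFilter t))
  have hdiv := (tendsto_div_ratioFilter t).sub hinv
  rw [sub_zero] at hdiv
  refine tendsto_ratioFilter_iff.2 ⟨(tendsto_sub_atTop_nat 1).comp (tendsto_fst_ratioFilter t),
    tendsto_snd_ratioFilter t, hdiv.congr' ?_⟩
  filter_upwards [(tendsto_fst_ratioFilter t).eventually_ge_atTop 1] with p hp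
  rw [Nat.cast_sub hp, Nat.cast_one, sub_div, one_div]

theorem tendsto_floor_ratioFilter {s t : ℝ} (hs : 0 < s) (ht : 0 < t) :
    Tendsto (fun p : ℕ × ℕ => (⌊(p.1 : ℝ) / t * s⌋₊, p.2)) (ratioFilter t) (ratioFilter s) := by
  have hx : Tendsto (fun p : ℕ × ℕ => (p.1 : ℝ) / t * s) (ratioFilter t) atTop :=
    ((tendsto_natCast_atTop_atTop.comp (tendsto_fst_ratioFilter t)).atTop_div_const
      ht).atTop_mul_const hs
  have hdiv := (tendsto_nat_floor_div_atTop.comp hx).mul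
    (((tendsto_div_ratioFilter t).div_const t).mul_const s)
  rw [div_self ht.ne', one_mul, one_mul] at hdiv
  refine tendsto_ratioFilter_iff.2 ⟨tendsto_nat_floor_atTop.comp hx,
    tendsto_snd_ratioFilter t, hdiv.congr' ?_⟩
  filter_upwards [(tendsto_fst_ratioFilter t).eventually_gt_atTop 0] with p hp
  have : (p.1 : ℝ) ≠ 0 := Nat.cast_ne_zero.2 hp.ne'
  simp only [Function.comp_apply]
  field_simp

theorem tendsto_zero_of_le_mul_comp_add {ι : Type*} {l : Filter ι} {τ : ι → ι}
    (hτ : Tendsto τ l l) {e d : ι → ℝ} {q C : ℝ} (hq0 : 0 ≤ q) (hq1 : q < 1)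
    (he0 : ∀ i, 0 ≤ e i) (heC : ∀ i, e i ≤ C) (hd : Tendsto d l (𝓝 0))
    (hrec : ∀ᶠ i in l, e i ≤ q * e (τ i) + d i) : Tendsto e l (𝓝 0) := by
  have iterated_bound : ∀ k : ℕ, ∀ ε > 0, ∀ᶠ i in l, e i ≤ C * q ^ k + ε := by
    intro k
    induction k with
    | zero => exact fun ε hε => .of_forall fun i => by linarith [heC i]
    | succ k ih =>
      intro ε hε
      filter_upwards [hrec, hτ.eventually (ih (ε / 2) (half_pos hε)),
        hd.eventually_le_const (half_pos hε)] with i hi hτi hdi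
      calc e i ≤ q * e (τ i) + d i := hi
        _ ≤ q * (C * q ^ k + ε / 2) + ε / 2 := by gcongr
        _ ≤ C * q ^ (k + 1) + ε := by rw [pow_succ]; nlinarith
  have hpow : Tendsto (fun k : ℕ => C * q ^ k) atTop (𝓝 0) := by
    simpa using (tendsto_pow_atTop_nhds_zero_of_lt_one hq0 hq1).const_mul C
  refine tendsto_order.2 ⟨fun b hb => .of_forall fun i => hb.trans_le (he0 i), fun ε hε => ?_⟩
  obtain ⟨k, hk⟩ := (hpow.eventually_lt_const (half_pos hε)).exists
  filter_upwards [iterated_bound k (ε / 2) (half_pos hε)] with i hi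
  linarith

theorem sum_range_eq_integral_floor {E : Type*} [NormedAddCommGroup E] [NormedSpace ℝ E]
    [CompleteSpace E] (g : ℕ → E) (n : ℕ) :
    ∑ m ∈ Finset.range n, g m = ∫ u in (0 : ℝ)..n, g ⌊u⌋₊ := by
  have hle (m : ℕ) : (m : ℝ) ≤ (m + 1 : ℕ) := by simp
  have hpiece (m : ℕ) : Set.EqOn (fun u : ℝ => g ⌊u⌋₊) (fun _ => g m)
      (Set.Ioo (m : ℝ) (m + 1 : ℕ)) := fun u hu => by
    simp only [(Nat.floor_eq_iff (m.cast_nonneg.trans hu.1.le)).2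
      ⟨hu.1.le, by simpa only [Nat.cast_add, Nat.cast_one] using hu.2⟩]
  have hint (m : ℕ) :
      IntervalIntegrable (fun u : ℝ => g ⌊u⌋₊) volume (m : ℝ) (m + 1 : ℕ) := by
    rw [intervalIntegrable_iff_integrableOn_Ioo_of_le (hle m)]
    exact (integrableOn_congr_fun (hpiece m) measurableSet_Ioo).2 (by simp)
  rw [← Nat.cast_zero, ← intervalIntegral.sum_integral_adjacent_intervals fun m _ => hint m]
  refine Finset.sum_congr rfl fun m _ => ?_
  rw [intervalIntegral.integral_of_le (hle m), integral_Ioc_eq_integral_Ioo,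
    setIntegral_congr_fun measurableSet_Ioo (hpiece m)]
  simp

theorem average_range_eq_integral_floor {E : Type*} [NormedAddCommGroup E] [NormedSpace ℝ E]
    [CompleteSpace E] (g : ℕ → E) {n : ℕ} (hn : n ≠ 0) {t : ℝ} (ht : 0 < t) :
    (n : ℝ)⁻¹ • ∑ m ∈ Finset.range n, g m
      = t⁻¹ • ∫ s in Set.Icc 0 t, g ⌊(n : ℝ) / t * s⌋₊ := by
  have hn' : (n : ℝ) ≠ 0 := Nat.cast_ne_zero.2 hn
  rw [sum_range_eq_integral_floor, integral_Icc_eq_integral_Ioc,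
    ← intervalIntegral.integral_of_le ht.le,
    intervalIntegral.integral_comp_mul_left (fun u => g ⌊u⌋₊) (div_ne_zero hn' ht.ne'),
    mul_zero, div_mul_cancel₀ _ ht.ne', smul_smul]
  congr 1
  field_simp

theorem ratioLimit_average {E : Type*} [NormedAddCommGroup E] [NormedSpace ℝ E]
    [CompleteSpace E] {X : ℕ → ℕ → E} {C t : ℝ} (ht : 0 < t) (hX : ∀ m N, ‖X m N‖ ≤ C)
    {L : ℝ → E} (hL : ∀ᵐ s ∂(volume.restrict (Set.Icc 0 t)), RatioLimit X s (L s)) :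
    RatioLimit (fun n N => (n : ℝ)⁻¹ • ∑ m ∈ Finset.range n, X m N) t
      (t⁻¹ • ∫ s in Set.Icc 0 t, L s) := by
  have hlim : Tendsto (fun p : ℕ × ℕ => ∫ s in Set.Icc 0 t, X ⌊(p.1 : ℝ) / t * s⌋₊ p.2)
      (ratioFilter t) (𝓝 (∫ s in Set.Icc 0 t, L s)) := by
    refine tendsto_integral_filter_of_dominated_convergence (fun _ => C) (.of_forall fun p => ?_)
      (.of_forall fun p => ae_of_all _ fun s => hX _ _) (by simp) ?_
    · have hfloor : Measurable fun s : ℝ => ⌊(p.1 : ℝ) / t * s⌋₊ :=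
        Nat.measurable_floor.comp (by fun_prop)
      exact ((StronglyMeasurable.of_discrete (f := fun m => X m p.2)).comp_measurable
        hfloor).aestronglyMeasurable
    · filter_upwards [hL, ae_restrict_of_ae (Measure.ae_ne volume 0),
        ae_restrict_mem measurableSet_Icc] with s hs hs0 hmem
      exact (ratioLimit_iff_tendsto.1 hs).comp
        (tendsto_floor_ratioFilter (hmem.1.lt_of_ne' hs0) ht)
  refine ratioLimit_iff_tendsto.2 ((hlim.const_smul t⁻¹).congr' ?_)
  filter_upwards [(tendsto_fst_ratioFilter t).eventually_gt_atTop 0] with p hp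
  exact (average_range_eq_integral_floor (fun m => X m p.2) hp.ne' ht).symm

theorem ratioLimit_schurIterate {a : ℕ → ℕ → ℂ} (ha : ∀ n N, ‖a n N‖ ≤ 1) {s : ℝ} {α : ℂ}
    (hα : ‖α‖ ≤ 1) (hlim : RatioLimit a s α) {z b : ℂ} (hz : ‖z‖ < 1)
    (hsmall : ‖z‖ < (1 - ‖z‖) ^ 2) (hb : ‖b‖ ≤ 1) (hfix : schurStep z α b = b) :
    RatioLimit (fun n N => schurIterate (fun k => a k N) z n) s b := by
  rw [ratioLimit_iff_tendsto] at hlim ⊢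
  have hS (n N : ℕ) : ‖schurIterate (fun k => a k N) z n‖ ≤ 1 :=
    norm_schurIterate_le (fun k => ha k N) hz.le n
  have hcont : ContinuousAt (fun β => ‖schurStep z β b - b‖) α := by
    have hne := one_sub_ne_zero_of_norm_lt_one (norm_mul_mul_lt_one hz hα hb)
    unfold schurStep
    fun_prop (disch := assumption)
  have hdefect : Tendsto (fun p : ℕ × ℕ => ‖schurStep z (a (p.1 - 1) p.2) b - b‖)
      (ratioFilter s) (𝓝 0) := by
    have := hcont.tendsto.comp (hlim.comp (tendsto_pred_ratioFilter s))
    rwa [hfix, sub_self, norm_zero] at this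
  rw [tendsto_iff_norm_sub_tendsto_zero]
  refine tendsto_zero_of_le_mul_comp_add (C := 2) (q := ‖z‖ / (1 - ‖z‖) ^ 2)
    (tendsto_pred_ratioFilter s) (by positivity)
    ((div_lt_one ((norm_nonneg z).trans_lt hsmall)).2 hsmall) (fun p => norm_nonneg _)
    (fun p => (norm_sub_le _ _).trans (by linarith [hS p.1 p.2])) hdefect ?_
  filter_upwards [(tendsto_fst_ratioFilter s).eventually_ge_atTop 1] with p hp
  obtain ⟨n, hn⟩ := Nat.exists_eq_add_of_le' hp
  rw [hn, Nat.add_sub_cancel, schurIterate]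
  refine (norm_sub_le_norm_sub_add_norm_sub _ (schurStep z (a n p.2) b) _).trans ?_
  gcongr
  exact norm_schurStep_sub_schurStep_le hz (ha n p.2) (hS n p.2) hb

/-! ### Potentials of the averaged measure and of the zero-counting measures -/

theorem averageArcMeasure_compl_sphere {t : ℝ} {α : ℝ → ℂ}
    (hα : AEMeasurable α (volume.restrict (Set.Icc 0 t))) :
    (averageArcMeasure t α : Measure ℂ) (Metric.sphere 0 1)ᶜ = 0 := by
  rw [averageArcMeasure_apply hα Metric.isClosed_sphere.measurableSet.compl]
  simp [arcMeasure_compl_sphere]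

theorem integral_bind_of_aemeasurable {Ω Ω' E : Type*} [MeasurableSpace Ω] [MeasurableSpace Ω']
    [NormedAddCommGroup E] [NormedSpace ℝ E] {μ : Measure Ω} {κ : Ω → Measure Ω'}
    (hκ : AEMeasurable κ μ) {g : Ω' → E} (hg : Integrable g (μ.bind κ)) :
    ∫ y, g y ∂μ.bind κ = ∫ x, ∫ y, g y ∂κ x ∂μ := by
  let K : ProbabilityTheory.Kernel Ω Ω' := ⟨hκ.mk κ, hκ.measurable_mk⟩
  have hbind : μ.bind κ = (K.comp (ProbabilityTheory.Kernel.const Unit μ)) () := by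
    rw [ProbabilityTheory.Kernel.comp_apply, ProbabilityTheory.Kernel.const_apply]
    exact Measure.bind_congr_right hκ.ae_eq_mk
  rw [hbind] at hg ⊢
  rw [ProbabilityTheory.Kernel.integral_comp hg, ProbabilityTheory.Kernel.const_apply]
  refine integral_congr_ae (hκ.ae_eq_mk.mono fun x hx => ?_)
  simp only [hx]
  rfl

theorem integral_averageArcMeasure {E : Type*} [NormedAddCommGroup E] [NormedSpace ℝ E]
    {t : ℝ} (ht : 0 < t) {α : ℝ → ℂ} (hα : AEMeasurable α (volume.restrict (Set.Icc 0 t)))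
    {g : ℂ → E} (hg : Integrable g (averageArcMeasure t α : Measure ℂ)) :
    ∫ ζ, g ζ ∂(averageArcMeasure t α : Measure ℂ)
      = t⁻¹ • ∫ s in Set.Icc 0 t, ∫ ζ, g ζ ∂arcMeasure ‖α s‖ := by
  let μ := (volume.restrict (Set.Icc 0 t)).bind fun s => arcMeasure ‖α s‖
  have harc : AEMeasurable (fun s => arcMeasure ‖α s‖) (volume.restrict (Set.Icc 0 t)) :=
    measurable_arcMeasure.comp_aemeasurable hα.norm
  have havg : (averageArcMeasure t α : Measure ℂ) = (ENNReal.ofReal t)⁻¹ • μ := rfl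
  rw [havg] at hg ⊢
  rw [integral_smul_measure, integral_bind_of_aemeasurable harc
    ((integrable_smul_measure (by simp) (by simpa using ht)).1 hg),
    ENNReal.toReal_inv, ENNReal.toReal_ofReal ht.le]

theorem logPotential_averageArcMeasure {t : ℝ} (ht : 0 < t) {α : ℝ → ℂ}
    (hα : AEMeasurable α (volume.restrict (Set.Icc 0 t))) {z : ℂ} (hz : ‖z‖ < 1) :
    logPotential (averageArcMeasure t α) z
      = t⁻¹ • ∫ s in Set.Icc 0 t, logPotential (arcMeasure ‖α s‖) z :=
  integral_averageArcMeasure ht hα (integrable_log_norm_one_sub_mul_conj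
    ((ae_norm_eq_one_of_compl_sphere (averageArcMeasure_compl_sphere hα)).mono fun _ => le_of_eq)
    hz)

theorem ratioLimit_log_norm_one_sub_mul_schurIterate {a : ℕ → ℕ → ℂ} (ha : ∀ n N, ‖a n N‖ ≤ 1)
    {s : ℝ} {α : ℂ} (hα : ‖α‖ ≤ 1) (hlim : RatioLimit a s α) {z : ℂ} (hz : ‖z‖ < 1)
    (hsmall : ‖z‖ < (1 - ‖z‖) ^ 2) :
    RatioLimit (fun n N => Real.log ‖1 - a n N * z * schurIterate (fun k => a k N) z n‖) s
      (logPotential (arcMeasure ‖α‖) z) := by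
  obtain ⟨b, hb, hfix⟩ := exists_schurStep_eq_self hz hsmall hα
  have hne := one_sub_ne_zero_of_norm_lt_one (norm_mul_mul_lt_one hz hα hb)
  have hschur := ratioLimit_schurIterate ha hα hlim hz hsmall hb hfix
  rw [ratioLimit_iff_tendsto] at hlim hschur ⊢
  rw [logPotential_arcMeasure (norm_nonneg α) hα hz (quadratic_of_schurStep_eq_self hne hfix)
    (norm_mul_one_sub_sq_lt hz hsmall hα hb)]
  exact (((hlim.mul_const z).mul hschur).const_sub 1).norm.log (norm_ne_zero_iff.2 hne)

theorem ratioLimit_logPotential_zeroMeasure {t : ℝ} (ht : 0 < t) {α : ℝ → ℂ}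
    (hα : AEMeasurable α (volume.restrict (Set.Icc 0 t)))
    (hα_le : ∀ s ∈ Set.Icc 0 t, ‖α s‖ ≤ 1) {a : ℕ → ℕ → ℂ} (ha : ∀ n N, ‖a n N‖ ≤ 1)
    (hlim : ∀ᵐ s ∂(volume.restrict (Set.Icc 0 t)), RatioLimit a s (α s)) {z : ℂ}
    (hz : ‖z‖ < 1) (hsmall : ‖z‖ < (1 - ‖z‖) ^ 2) :
    RatioLimit (fun n N => logPotential (zeroMeasure (fun k => a k N) n) z) t
      (logPotential (averageArcMeasure t α) z) := by
  simp only [logPotential_zeroMeasure (fun k => ha k _) _ hz,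
    logPotential_averageArcMeasure ht hα hz]
  refine ratioLimit_average ht (C := -Real.log (1 - ‖z‖)) (fun n N => ?_) ?_
  · have hS := norm_schurIterate_le (fun k => ha k N) hz.le n
    exact abs_log_norm_one_sub_le (norm_mul_mul_le (ha n N) hS) hz
  · filter_upwards [hlim, ae_restrict_mem measurableSet_Icc] with s hs hmem
    exact ratioLimit_log_norm_one_sub_mul_schurIterate ha (hα_le s hmem) hs hz hsmall

/-! ### Moments from potentials -/

theorem circleAverage_zpow {R : ℝ} (hR : 0 < R) (m : ℤ) :
    Real.circleAverage (fun z : ℂ => z ^ m) 0 R = if m = 0 then 1 else 0 := by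
  split_ifs with hm
  · simpa only [hm, zpow_zero] using Real.circleAverage_const (1 : ℂ) 0 R
  · have hcongr : Set.EqOn (fun z : ℂ => (z - 0)⁻¹ • z ^ m) (fun z => (z - 0) ^ (m - 1))
        (Metric.sphere 0 R) := fun z hz => by
      have hz0 : z ≠ 0 := ne_zero_of_mem_sphere hR.ne' ⟨z, hz⟩
      simp only [sub_zero, smul_eq_mul, zpow_sub_one₀ hz0, mul_comm]
    rw [Real.circleAverage_eq_circleIntegral hR.ne', circleIntegral.integral_congr hR.le hcongr,
      circleIntegral.integral_sub_zpow_of_ne (by omega), smul_zero]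

theorem tendsto_circleAverage_of_norm_le {ι E : Type*} [NormedAddCommGroup E] [NormedSpace ℝ E]
    {l : Filter ι} [l.IsCountablyGenerated] {F : ι → ℂ → E} {f : ℂ → E} {c : ℂ} {R C : ℝ}
    (hF : ∀ i, StronglyMeasurable (F i))
    (hC : ∀ᶠ i in l, ∀ z ∈ Metric.sphere c |R|, ‖F i z‖ ≤ C)
    (hlim : ∀ z ∈ Metric.sphere c |R|, Tendsto (fun i => F i z) l (𝓝 (f z))) :
    Tendsto (fun i => Real.circleAverage (F i) c R) l (𝓝 (Real.circleAverage f c R)) :=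
  (intervalIntegral.tendsto_integral_filter_of_dominated_convergence (fun _ => C)
    (Eventually.of_forall fun i =>
      ((hF i).comp_measurable (measurable_circleMap c R)).aestronglyMeasurable)
    (hC.mono fun _ hi => ae_of_all _ fun θ _ => hi _ (circleMap_mem_sphere' c R θ))
    intervalIntegrable_const
    (ae_of_all _ fun θ _ => hlim _ (circleMap_mem_sphere' c R θ))).const_smul _

theorem hasSum_circleAverage_of_norm_le {E : Type*} [NormedAddCommGroup E] [NormedSpace ℝ E]
    {f : ℕ → ℂ → E} {g : ℂ → E} {u : ℕ → ℝ} {c : ℂ} {R : ℝ}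
    (hf : ∀ n, ContinuousOn (f n) (Metric.sphere c |R|)) (hu : Summable u)
    (hfu : ∀ n, ∀ z ∈ Metric.sphere c |R|, ‖f n z‖ ≤ u n)
    (hg : ∀ z ∈ Metric.sphere c |R|, HasSum (fun n => f n z) (g z)) :
    HasSum (fun n => Real.circleAverage (f n) c R) (Real.circleAverage g c R) := by
  have hmem : ∀ θ, circleMap c R θ ∈ Metric.sphere c |R| := circleMap_mem_sphere' c R
  refine (intervalIntegral.hasSum_integral_of_dominated_convergence (fun n _ => u n) (fun n => ?_)
    (fun n => ae_of_all _ fun θ _ => hfu n _ (hmem θ)) (ae_of_all _ fun _ _ => hu)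
    intervalIntegrable_const (ae_of_all _ fun θ _ => hg _ (hmem θ))).const_smul _
  exact ((hf n).comp_continuous (continuous_circleMap c R) hmem).aestronglyMeasurable

theorem integral_circleAverage_comm {Ω E : Type*} [MeasurableSpace Ω] [NormedAddCommGroup E]
    [NormedSpace ℝ E] {μ : Measure Ω} [IsFiniteMeasure μ] {F : ℂ → Ω → E} {c : ℂ} {R C : ℝ}
    (hF : StronglyMeasurable (Function.uncurry F))
    (hC : ∀ᵐ ω ∂μ, ∀ z ∈ Metric.sphere c |R|, ‖F z ω‖ ≤ C) :
    ∫ ω, Real.circleAverage (fun z => F z ω) c R ∂μ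
      = Real.circleAverage (fun z => ∫ ω, F z ω ∂μ) c R := by
  simp only [Real.circleAverage_def, intervalIntegral.integral_of_le Real.two_pi_pos.le]
  rw [integral_smul, integral_integral_swap]
  have hmeas : Measurable fun p : Ω × ℝ => (circleMap c R p.2, p.1) :=
    ((measurable_circleMap c R).comp measurable_snd).prodMk measurable_fst
  refine Integrable.of_bound (hF.comp_measurable hmeas).aestronglyMeasurable C ?_
  filter_upwards [Measure.quasiMeasurePreserving_fst.ae hC] with p hp
  exact hp _ (circleMap_mem_sphere' c R p.2)

theorem hasSum_log_norm_one_sub {v : ℂ} (hv : ‖v‖ < 1) :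
    HasSum (fun n : ℕ => -(v ^ n + conj v ^ n) / (2 * n)) (Real.log ‖1 - v‖ : ℂ) := by
  have hlog := Complex.hasSum_taylorSeries_neg_log hv
  have hre : -1 / 2 * (-Complex.log (1 - v) + conj (-Complex.log (1 - v)))
      = (Real.log ‖1 - v‖ : ℂ) := by
    rw [← Complex.log_re, Complex.add_conj, Complex.neg_re]
    push_cast
    ring
  rw [← hre]
  refine ((hlog.add (Complex.hasSum_conj'.2 hlog)).mul_left (-1 / 2)).congr_fun fun n => ?_
  rw [map_div₀, map_pow, Complex.conj_natCast]
  ring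

theorem norm_neg_pow_add_conj_pow_div_le (v : ℂ) (n : ℕ) :
    ‖-(v ^ n + conj v ^ n) / (2 * n)‖ ≤ ‖v‖ ^ n := by
  rcases Nat.eq_zero_or_pos n with rfl | hn
  · simp
  have hadd : ‖v ^ n + conj v ^ n‖ ≤ 2 * ‖v‖ ^ n := by
    refine (norm_add_le _ _).trans_eq ?_
    rw [norm_pow, norm_pow, Complex.norm_conj, two_mul]
  have hn1 : (1 : ℝ) ≤ n := by exact_mod_cast hn
  rw [norm_div, norm_neg, norm_mul, Complex.norm_ofNat, Complex.norm_natCast,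
    div_le_iff₀ (by positivity)]
  nlinarith [pow_nonneg (norm_nonneg v) n]

theorem circleAverage_pow_mul_add_conj {r : ℝ} (hr : 0 < r) (w : ℂ) {k : ℕ} (hk : k ≠ 0) (n : ℕ) :
    Real.circleAverage (fun z => z ^ k * ((z * conj w) ^ n + conj (z * conj w) ^ n)) 0 r
      = if n = k then (r : ℂ) ^ (2 * k) * w ^ k else 0 := by
  have hcongr : Set.EqOn (fun z : ℂ => z ^ k * ((z * conj w) ^ n + conj (z * conj w) ^ n))
      (fun z => conj w ^ n • z ^ ((k : ℤ) + n) + ((r : ℂ) ^ (2 * n) * w ^ n) • z ^ ((k : ℤ) - n))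
      (Metric.sphere 0 |r|) := fun z hz => by
    have hz0 : z ≠ 0 := ne_zero_of_mem_sphere (abs_pos.2 hr.ne').ne' ⟨z, hz⟩
    have hconj : z * conj z = (r : ℂ) ^ 2 := by
      rw [Complex.mul_conj', mem_sphere_zero_iff_norm.1 hz]
      exact_mod_cast sq_abs r
    simp only [smul_eq_mul, map_mul, Complex.conj_conj, zpow_sub₀ hz0, zpow_add₀ hz0,
      zpow_natCast, pow_mul, ← hconj, mul_pow]
    field_simp
  have hint : ∀ m : ℤ, CircleIntegrable (fun z : ℂ => z ^ m) 0 r := fun m =>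
    ContinuousOn.circleIntegrable hr.le fun z hz =>
      (continuousAt_zpow₀ z m (.inl (ne_zero_of_mem_sphere hr.ne' ⟨z, hz⟩))).continuousWithinAt
  rw [Real.circleAverage_congr_sphere hcongr,
    Real.circleAverage_fun_add ((hint _).const_fun_smul) ((hint _).const_fun_smul),
    Real.circleAverage_fun_smul, Real.circleAverage_fun_smul, circleAverage_zpow hr,
    circleAverage_zpow hr, if_neg (by omega), smul_zero, zero_add]
  rcases eq_or_ne n k with rfl | hnk
  · simp
  · rw [if_neg (by omega), if_neg hnk, smul_zero]

theorem circleAverage_pow_mul_log_norm {r : ℝ} (hr : 0 < r) {w : ℂ} (hw : r * ‖w‖ < 1) {k : ℕ}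
    (hk : k ≠ 0) :
    Real.circleAverage (fun z => z ^ k * (Real.log ‖1 - z * conj w‖ : ℂ)) 0 r
      = -(r : ℂ) ^ (2 * k) / (2 * k) * w ^ k := by
  have hr' : ∀ z ∈ Metric.sphere (0 : ℂ) |r|, ‖z‖ = r := fun z hz => by
    rw [mem_sphere_zero_iff_norm.1 hz, abs_of_pos hr]
  have hnorm : ∀ z ∈ Metric.sphere (0 : ℂ) |r|, ‖z * conj w‖ = r * ‖w‖ := fun z hz => by
    rw [norm_mul, Complex.norm_conj, hr' z hz]
  have hbound : ∀ n : ℕ, ∀ z ∈ Metric.sphere (0 : ℂ) |r|,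
      ‖z ^ k * (-((z * conj w) ^ n + conj (z * conj w) ^ n) / (2 * n))‖
        ≤ r ^ k * (r * ‖w‖) ^ n := fun n z hz => by
    rw [norm_mul, norm_pow, hr' z hz, ← hnorm z hz]
    gcongr
    exact norm_neg_pow_add_conj_pow_div_le _ n
  have hsum := hasSum_circleAverage_of_norm_le (fun n => by fun_prop)
    ((summable_geometric_of_lt_one (by positivity) hw).mul_left _) hbound fun z hz =>
      (hasSum_log_norm_one_sub ((hnorm z hz).trans_lt hw)).mul_left (z ^ k)
  have hterm : ∀ n : ℕ, Real.circleAverage (fun z =>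
      z ^ k * (-((z * conj w) ^ n + conj (z * conj w) ^ n) / (2 * n))) 0 r
        = if n = k then -(r : ℂ) ^ (2 * k) / (2 * k) * w ^ k else 0 := fun n => by
    have hsmul : ∀ z : ℂ, z ^ k * (-((z * conj w) ^ n + conj (z * conj w) ^ n) / (2 * n))
        = (-1 / (2 * n) : ℂ) • (z ^ k * ((z * conj w) ^ n + conj (z * conj w) ^ n)) :=
      fun z => by rw [smul_eq_mul]; ring
    simp only [hsmul, Real.circleAverage_fun_smul, circleAverage_pow_mul_add_conj hr w hk]
    split_ifs with h
    · rw [h, smul_eq_mul]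
      ring
    · exact smul_zero _
  simp only [hterm] at hsum
  exact hsum.unique (hasSum_ite_eq k _)

theorem abs_logPotential_le {μ : Measure ℂ} [IsFiniteMeasure μ] (hμ : ∀ᵐ ζ ∂μ, ‖ζ‖ ≤ 1) {z : ℂ}
    (hz : ‖z‖ < 1) :
    |logPotential μ z| ≤ -Real.log (1 - ‖z‖) * μ.real Set.univ :=
  norm_integral_le_of_norm_le_const (f := fun ζ => Real.log ‖1 - z * conj ζ‖)
    (hμ.mono fun _ hζ => abs_log_norm_one_sub_mul_conj_le hz hζ)

theorem measurable_logPotential (μ : Measure ℂ) [SFinite μ] : Measurable (logPotential μ) :=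
  measurable_log_norm_one_sub_mul_conj.stronglyMeasurable.integral_prod_right.measurable

theorem integral_pow_eq_circleAverage_logPotential {μ : Measure ℂ} [IsFiniteMeasure μ]
    (hμ : ∀ᵐ ζ ∂μ, ‖ζ‖ ≤ 1) {r : ℝ} (hr : 0 < r) (hr1 : r < 1) {k : ℕ} (hk : k ≠ 0) :
    -(r : ℂ) ^ (2 * k) / (2 * k) * ∫ ζ, ζ ^ k ∂μ
      = Real.circleAverage (fun z => z ^ k * (logPotential μ z : ℂ)) 0 r := by
  have hmeas : StronglyMeasurable (Function.uncurry fun z ζ : ℂ =>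
      z ^ k * (Real.log ‖1 - z * conj ζ‖ : ℂ)) :=
    Measurable.stronglyMeasurable ((measurable_fst.pow_const k).mul
      (Complex.measurable_ofReal.comp measurable_log_norm_one_sub_mul_conj))
  have hbound : ∀ᵐ ζ ∂μ, ∀ z ∈ Metric.sphere (0 : ℂ) |r|,
      ‖z ^ k * (Real.log ‖1 - z * conj ζ‖ : ℂ)‖ ≤ r ^ k * -Real.log (1 - r) := by
    filter_upwards [hμ] with ζ hζ z hz
    rw [mem_sphere_zero_iff_norm, abs_of_pos hr] at hz
    rw [norm_mul, norm_pow, Complex.norm_real, hz, Real.norm_eq_abs, ← hz]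
    gcongr
    exact abs_log_norm_one_sub_mul_conj_le (hz.trans_lt hr1) hζ
  calc -(r : ℂ) ^ (2 * k) / (2 * k) * ∫ ζ, ζ ^ k ∂μ
      = ∫ ζ, Real.circleAverage (fun z => z ^ k * (Real.log ‖1 - z * conj ζ‖ : ℂ)) 0 r ∂μ := by
        rw [← integral_const_mul]
        refine integral_congr_ae (hμ.mono fun ζ hζ =>
          (circleAverage_pow_mul_log_norm hr ?_ hk).symm)
        exact (mul_le_of_le_one_right hr.le hζ).trans_lt hr1
    _ = Real.circleAverage (fun z => ∫ ζ, z ^ k * (Real.log ‖1 - z * conj ζ‖ : ℂ) ∂μ) 0 r :=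
        integral_circleAverage_comm hmeas hbound
    _ = Real.circleAverage (fun z => z ^ k * (logPotential μ z : ℂ)) 0 r := by
        simp only [integral_const_mul, integral_complex_ofReal, logPotential]

theorem tendsto_integral_pow_of_tendsto_logPotential {ι : Type*} {l : Filter ι}
    [l.IsCountablyGenerated] {μ : ι → Measure ℂ} {ν : Measure ℂ} [∀ i, IsFiniteMeasure (μ i)]
    [IsFiniteMeasure ν] (hμ : ∀ i, ∀ᵐ ζ ∂μ i, ‖ζ‖ ≤ 1) (hν : ∀ᵐ ζ ∂ν, ‖ζ‖ ≤ 1)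
    (hmass : Tendsto (fun i => (μ i).real Set.univ) l (𝓝 (ν.real Set.univ)))
    {r : ℝ} (hr : 0 < r) (hr1 : r < 1)
    (hpot : ∀ z : ℂ, ‖z‖ = r →
      Tendsto (fun i => logPotential (μ i) z) l (𝓝 (logPotential ν z))) (k : ℕ) :
    Tendsto (fun i => ∫ ζ, ζ ^ k ∂μ i) l (𝓝 (∫ ζ, ζ ^ k ∂ν)) := by
  rcases eq_or_ne k 0 with rfl | hk
  · simpa [Function.comp_def] using (Complex.continuous_ofReal.tendsto _).comp hmass
  have hc : -(r : ℂ) ^ (2 * k) / (2 * k) ≠ 0 :=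
    div_ne_zero (neg_ne_zero.2 (pow_ne_zero _ (Complex.ofReal_ne_zero.2 hr.ne')))
      (mul_ne_zero two_ne_zero (Nat.cast_ne_zero.2 hk))
  have hr' : ∀ z ∈ Metric.sphere (0 : ℂ) |r|, ‖z‖ = r := fun z hz => by
    rw [mem_sphere_zero_iff_norm.1 hz, abs_of_pos hr]
  rw [← tendsto_const_smul_iff₀ hc]
  simp only [smul_eq_mul, integral_pow_eq_circleAverage_logPotential (hμ _) hr hr1 hk,
    integral_pow_eq_circleAverage_logPotential hν hr hr1 hk]
  refine tendsto_circleAverage_of_norm_le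
    (C := r ^ k * (-Real.log (1 - r) * (ν.real Set.univ + 1))) (fun i => ?_) ?_ fun z hz =>
      ((Complex.continuous_ofReal.tendsto _).comp (hpot z (hr' z hz))).const_mul _
  · exact ((measurable_id.pow_const k).mul
      (Complex.measurable_ofReal.comp (measurable_logPotential (μ i)))).stronglyMeasurable
  · filter_upwards [hmass.eventually_le_const (lt_add_one _)] with i hi z hz
    have hlog : 0 ≤ -Real.log (1 - r) :=
      neg_nonneg.2 (Real.log_nonpos (sub_nonneg.2 hr1.le) (sub_le_self 1 hr.le))
    rw [norm_mul, norm_pow, hr' z hz, Complex.norm_real]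
    gcongr
    refine (abs_logPotential_le (hμ i) ((hr' z hz).trans_lt hr1)).trans ?_
    rw [hr' z hz]
    gcongr

/-! ### Weak convergence from moments -/

theorem exists_sum_zpow_norm_sub_lt {f : ℂ → ℂ} (hf : ContinuousOn f (Metric.sphere 0 1)) {ε : ℝ}
    (hε : 0 < ε) :
    ∃ c : ℤ →₀ ℂ, ∀ ζ ∈ Metric.sphere (0 : ℂ) 1, ‖f ζ - ∑ m ∈ c.support, c m * ζ ^ m‖ < ε := by
  have : Fact (0 < 2 * Real.pi) := ⟨Real.two_pi_pos⟩
  let F : C(AddCircle (2 * Real.pi), ℂ) := ⟨fun x => f (AddCircle.toCircle x),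
    hf.comp_continuous (by fun_prop) fun x => (AddCircle.toCircle x).2⟩
  have hF : F ∈ (Submodule.span ℂ (Set.range (@fourier (2 * Real.pi)))).topologicalClosure := by
    rw [span_fourier_closure_eq_top]
    exact Submodule.mem_top
  obtain ⟨g, hg, hFg⟩ := Metric.mem_closure_iff.1 hF ε hε
  obtain ⟨c, rfl⟩ := Finsupp.mem_span_range_iff_exists_finsupp.1 hg
  refine ⟨c, fun ζ hζ => ?_⟩
  obtain ⟨x, hx⟩ := (AddCircle.homeomorphCircle Real.two_pi_pos.ne').surjective ⟨ζ, hζ⟩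
  rw [AddCircle.homeomorphCircle_apply] at hx
  have hxζ : (AddCircle.toCircle x : ℂ) = ζ := congrArg Subtype.val hx
  have hFx := (F - _).norm_coe_le_norm x |>.trans_lt (dist_eq_norm F _ ▸ hFg)
  simpa [F, Finsupp.sum, fourier_apply, AddCircle.toCircle_zsmul, hxζ] using hFx

theorem tendsto_integral_zpow_of_tendsto_integral_pow {ι : Type*} {l : Filter ι}
    {μ : ι → Measure ℂ} {ν : Measure ℂ} (hμ : ∀ i, ∀ᵐ ζ ∂μ i, ‖ζ‖ = 1) (hν : ∀ᵐ ζ ∂ν, ‖ζ‖ = 1)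
    (hmom : ∀ k : ℕ, Tendsto (fun i => ∫ ζ, ζ ^ k ∂μ i) l (𝓝 (∫ ζ, ζ ^ k ∂ν))) (m : ℤ) :
    Tendsto (fun i => ∫ ζ, ζ ^ m ∂μ i) l (𝓝 (∫ ζ, ζ ^ m ∂ν)) := by
  obtain ⟨k, rfl | rfl⟩ := m.eq_nat_or_neg
  · simpa only [zpow_natCast] using hmom k
  · have hconj : ∀ {σ : Measure ℂ}, (∀ᵐ ζ ∂σ, ‖ζ‖ = 1) →
        ∫ ζ, ζ ^ (-(k : ℤ)) ∂σ = conj (∫ ζ, ζ ^ k ∂σ) := fun hσ => by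
      rw [← integral_conj]
      refine integral_congr_ae (hσ.mono fun ζ hζ => ?_)
      simp only [zpow_neg, zpow_natCast, map_pow, ← inv_pow, Complex.inv_eq_conj hζ]
    simp only [hconj (hμ _), hconj hν]
    exact (Complex.continuous_conj.tendsto _).comp (hmom k)

theorem integrable_zpow {μ : Measure ℂ} [IsFiniteMeasure μ] (hμ : ∀ᵐ ζ ∂μ, ‖ζ‖ = 1) (m : ℤ) :
    Integrable (fun ζ => ζ ^ m) μ :=
  Integrable.of_bound (by fun_prop) 1
    (hμ.mono fun ζ hζ => by rw [norm_zpow, hζ, one_zpow])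

theorem dist_integral_sum_zpow_le {μ : Measure ℂ} [IsFiniteMeasure μ] (hμ : ∀ᵐ ζ ∂μ, ‖ζ‖ = 1)
    {f : ℂ → ℂ} (hf : Integrable f μ) {c : ℤ →₀ ℂ} {δ : ℝ}
    (hδ : ∀ ζ ∈ Metric.sphere (0 : ℂ) 1, ‖f ζ - ∑ m ∈ c.support, c m * ζ ^ m‖ < δ) :
    dist (∫ ζ, f ζ ∂μ) (∑ m ∈ c.support, c m * ∫ ζ, ζ ^ m ∂μ) ≤ δ * μ.real Set.univ := by
  have hint : ∀ m ∈ c.support, Integrable (fun ζ => c m * ζ ^ m) μ :=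
    fun m _ => (integrable_zpow hμ m).const_mul _
  simp only [← integral_const_mul]
  rw [← integral_finsetSum _ hint, dist_eq_norm, ← integral_sub hf (integrable_finsetSum _ hint)]
  exact norm_integral_le_of_norm_le_const
    (hμ.mono fun ζ hζ => (hδ ζ (mem_sphere_zero_iff_norm.2 hζ)).le)

theorem tendsto_of_tendsto_integral_pow {ι : Type*} {l : Filter ι} {μ : ι → FiniteMeasure ℂ}
    {ν : FiniteMeasure ℂ} (hμ : ∀ i, ∀ᵐ ζ ∂(μ i : Measure ℂ), ‖ζ‖ = 1)
    (hν : ∀ᵐ ζ ∂(ν : Measure ℂ), ‖ζ‖ = 1)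
    (hmom : ∀ k : ℕ, Tendsto (fun i => ∫ ζ, ζ ^ k ∂(μ i : Measure ℂ)) l
      (𝓝 (∫ ζ, ζ ^ k ∂(ν : Measure ℂ)))) :
    Tendsto μ l (𝓝 ν) := by
  have hmass : Tendsto (fun i => (μ i : Measure ℂ).real Set.univ) l
      (𝓝 ((ν : Measure ℂ).real Set.univ)) := by
    simpa [Function.comp_def] using (Complex.continuous_re.tendsto _).comp (hmom 0)
  rw [FiniteMeasure.tendsto_iff_forall_integral_rclike_tendsto ℂ]
  intro f
  rw [Metric.tendsto_nhds]
  intro ε hε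
  let C := (ν : Measure ℂ).real Set.univ + 1
  have hC : 0 < C := by positivity
  have hint : ∀ σ : FiniteMeasure ℂ, Integrable f (σ : Measure ℂ) := fun σ => f.integrable _
  obtain ⟨c, hc⟩ := exists_sum_zpow_norm_sub_lt f.continuous.continuousOn
    (show 0 < ε / (3 * C) by positivity)
  have hle : ∀ {x : ℝ}, x ≤ C → ε / (3 * C) * x ≤ ε / 3 := fun {x} hx => by
    calc ε / (3 * C) * x ≤ ε / (3 * C) * C := by gcongr
      _ = ε / 3 := by field_simp
  have hsum : Tendsto (fun i => ∑ m ∈ c.support, c m * ∫ ζ, ζ ^ m ∂(μ i : Measure ℂ)) l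
      (𝓝 (∑ m ∈ c.support, c m * ∫ ζ, ζ ^ m ∂(ν : Measure ℂ))) :=
    tendsto_finsetSum _ fun m _ =>
      (tendsto_integral_zpow_of_tendsto_integral_pow hμ hν hmom m).const_mul _
  filter_upwards [Metric.tendsto_nhds.1 hsum (ε / 3) (by positivity),
    hmass.eventually_le_const (lt_add_one _)] with i hi hmi
  have hμi := (dist_integral_sum_zpow_le (hμ i) (hint _) hc).trans (hle hmi)
  have hνi := (dist_integral_sum_zpow_le hν (hint _) hc).trans (hle (lt_add_one _).le)
  rw [dist_comm] at hνi
  exact (dist_triangle4 _ _ _ _).trans_lt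
    ((add_lt_add_of_lt_of_le (add_lt_add_of_le_of_lt hμi hi) hνi).trans_eq (add_thirds ε))

theorem tendsto_balayage_of_tendsto_logPotential {ι : Type*} {l : Filter ι}
    [l.IsCountablyGenerated] {μ : ι → FiniteMeasure ℂ} {ν : FiniteMeasure ℂ}
    (hμ : ∀ i, ∀ᵐ ζ ∂(μ i : Measure ℂ), ‖ζ‖ ≤ 1) (hν : ∀ᵐ ζ ∂(ν : Measure ℂ), ‖ζ‖ = 1)
    (hmass : Tendsto (fun i => (μ i : Measure ℂ).real Set.univ) l
      (𝓝 ((ν : Measure ℂ).real Set.univ)))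
    {r : ℝ} (hr : 0 < r) (hr1 : r < 1)
    (hpot : ∀ z : ℂ, ‖z‖ = r →
      Tendsto (fun i => logPotential (μ i) z) l (𝓝 (logPotential ν z))) :
    Tendsto (fun i => balayage (μ i)) l (𝓝 ν) := by
  refine tendsto_of_tendsto_integral_pow
    (fun i => ae_norm_eq_one_of_compl_sphere (balayage_sphere _ (hμ i))) hν fun k => ?_
  simp only [integral_balayage_pow _ (hμ _)]
  exact tendsto_integral_pow_of_tendsto_logPotential hμ (hν.mono fun _ => le_of_eq) hmass hr hr1
    hpot k

end VaryingOPUC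

-- A coefficient with `‖a n N‖ = 1` produces a paraorthogonal polynomial, with all its zeros on the
-- circle.
theorem theorem5p1_general (t : ℝ) (ht : 0 < t) (α : ℝ → ℂ)
    (hα : AEMeasurable α (volume.restrict (Set.Icc 0 t)))
    (hα_le : ∀ s ∈ Set.Icc 0 t, ‖α s‖ ≤ 1)
    (a : ℕ → ℕ → ℂ) (ha : ∀ n N, ‖a n N‖ ≤ 1)
    (hlim : ∀ᵐ s ∂(volume.restrict (Set.Icc 0 t)), VaryingOPUC.RatioLimit a s (α s)) :
    VaryingOPUC.RatioLimit
      (fun n N => VaryingOPUC.balayage (VaryingOPUC.zeroMeasure (fun k => a k N) n))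
      t (VaryingOPUC.averageArcMeasure t α) := by
  have hpot : ∀ z : ℂ, ‖z‖ = 1 / 4 → VaryingOPUC.RatioLimit
      (fun n N => VaryingOPUC.logPotential (VaryingOPUC.zeroMeasure (fun k => a k N) n) z) t
      (VaryingOPUC.logPotential (VaryingOPUC.averageArcMeasure t α) z) := fun z hz =>
    VaryingOPUC.ratioLimit_logPotential_zeroMeasure ht hα hα_le ha hlim (by rw [hz]; norm_num)
      (by rw [hz]; norm_num)
  have := VaryingOPUC.isProbabilityMeasure_averageArcMeasure ht hα
  have hmass : VaryingOPUC.RatioLimit (fun n N =>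
      (VaryingOPUC.zeroMeasure (fun k => a k N) n : Measure ℂ).real Set.univ) t
      ((VaryingOPUC.averageArcMeasure t α : Measure ℂ).real Set.univ) := by
    intro n N hn _ _
    refine tendsto_nhds_of_eventually_eq ((hn.eventually_ne_atTop 0).mono fun j hj => ?_)
    have := VaryingOPUC.isProbabilityMeasure_zeroMeasure (fun k => a k (N j)) (n j) hj
    exact probReal_univ.trans probReal_univ.symm
  simp only [VaryingOPUC.ratioLimit_iff_tendsto] at hpot hmass ⊢
  exact VaryingOPUC.tendsto_balayage_of_tendsto_logPotential
    (fun p => VaryingOPUC.zeroMeasure_ae_norm_le (fun k => ha k p.2) p.1)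
    (VaryingOPUC.ae_norm_eq_one_of_compl_sphere (VaryingOPUC.averageArcMeasure_compl_sphere hα))
    hmass (by norm_num) (by norm_num) hpot

theorem theorem5p1 (t : ℝ) (ht : 0 < t) (α : ℝ → ℂ)
    (hα : AEMeasurable α (volume.restrict (Set.Icc 0 t)))
    (hα_le : ∀ s ∈ Set.Icc 0 t, ‖α s‖ ≤ 1)
    (a : ℕ → ℕ → ℂ) (ha : ∀ n N, ‖a n N‖ < 1)
    (hlim : ∀ᵐ s ∂(volume.restrict (Set.Icc 0 t)), VaryingOPUC.RatioLimit a s (α s)) :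
    VaryingOPUC.RatioLimit
      (fun n N => VaryingOPUC.balayage (VaryingOPUC.zeroMeasure (fun k => a k N) n))
      t (VaryingOPUC.averageArcMeasure t α) :=
  theorem5p1_general t ht α hα hα_le a (fun n N => (ha n N).le) hlim
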